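/- Let $n\ge 0$ be an integer and let $M$ be a random $n\times n$ matrix from the complex Ginibre ensemble, that is, the entries $M_{ij}$ are independent and each is distributed as $\xi+\mathrm{i}\eta$ with $\xi,\eta$ independent standard real Gaussian random variables (mean $0$, variance $1$). Let $X_1,\dots,X_n$ be independent random variables such that $X_k$ has the $\chi$ distribution with $2k$ degrees of freedom, i.e. density $$\frac{x^{2k-1}\mathrm{e}^{-x^2/2}}{2^{k-1}\,\Gamma(k)},\qquad x>0.$$ Let $\lambda_1,\dots,\lambda_n$ be the eigenvalues of $M$, repeated according to algebraic multiplicity. Then the random multisets $\{|\lambda_1|,\dots,|\lambda_n|\}$ and $\{X_1,\dots,X_n\}$ have the same distribution (with respect to the $\sigma$-algebra on finite multisets of real numbers generated by the maps that count the points in a Borel set). -/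

import Mathlib

open MeasureTheory ProbabilityTheory

namespace Ginibre

/-- The `χ` distribution with `k` degrees of freedom (for `k ≥ 1`): the measure on `ℝ` that is
supported on the positive half-line, with density
`x ^ (k - 1) * exp (-x² / 2) / (2 ^ (k / 2 - 1) * Γ (k / 2))` there. -/
noncomputable def chiMeasure (k : ℕ) : Measure ℝ :=
  (volume.restrict (Set.Ioi 0)).withDensity fun x =>
    ENNReal.ofReal (x ^ ((k : ℝ) - 1) * Real.exp (-x ^ 2 / 2) /
      (2 ^ ((k : ℝ) / 2 - 1) * Real.Gamma ((k : ℝ) / 2)))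

/-- The law of `ξ + i η`, where `ξ` and `η` are independent standard real Gaussians. -/
noncomputable def complexGaussian : Measure ℂ :=
  ((gaussianReal 0 1).prod (gaussianReal 0 1)).map fun p => (⟨p.1, p.2⟩ : ℂ)

/-- A random matrix from the `n × n` complex Ginibre ensemble: all the entries are independent
complex Gaussians, whose real and imaginary parts are independent standard real Gaussians. -/
structure IsGinibre {Ω : Type*} [MeasurableSpace Ω] {n : ℕ}
    (M : Ω → Matrix (Fin n) (Fin n) ℂ) (P : Measure Ω) : Prop where
  entry_law : ∀ i j, HasLaw (fun ω => M ω i j) complexGaussian P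
  entry_indep : iIndepFun (fun (p : Fin n × Fin n) ω => M ω p.1 p.2) P

/-- The multiset of moduli of the eigenvalues of a complex matrix; each eigenvalue is counted with
its algebraic multiplicity. -/
noncomputable def eigenvalueModuli {n : ℕ} (A : Matrix (Fin n) (Fin n) ℂ) : Multiset ℝ :=
  A.charpoly.roots.map fun z => ‖z‖

open Classical in
/-- The usual σ-algebra for finite point configurations: the smallest one for which, for each
measurable set `B`, the number of points in `B` (with multiplicity) is a measurable function. -/
noncomputable instance instMeasurableSpaceMultiset {α : Type*} [MeasurableSpace α] :
    MeasurableSpace (Multiset α) :=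
  ⨆ (B : Set α) (_ : MeasurableSet B),
    MeasurableSpace.comap (fun s : Multiset α => s.countP (· ∈ B)) ⊤

end Ginibre

/-! The eigenvalues have a joint density proportional to the product of the Gaussian weights
exp(-|z_i|²/2) and the squared modulus of the Vandermonde determinant. Integrate it against a
product of f(|z_i|) and expand the determinant: distinct powers of z are orthogonal for a
rotation-invariant weight, so only diagonal terms survive. What remains is n! times the product over
k < n of the integrals of f(|z|) |z|^(2k) exp(-|z|²/2) (`jointIntegral_radial`). In polar
coordinates the k-th factor is a constant multiple of the expectation of f under the χ law with
2(k+1) degrees of freedom (`exists_lintegral_chiMeasure_eq`). The choice f = 1 matches the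
constants, and expectations of such products determine the law of a configuration of n points
(`identDistrib_of_lintegral_prod_eq`).

The joint density comes from splitting off one eigenvalue at a time. Write a matrix of size n + 1 in
blocks a, b, c, D, and replace the column c by a vector u such that (1, u) is an eigenvector: with z
= a + b·u this means c = zu - Du. The real Jacobian of u ↦ c is |χ(z)|², where χ is the
characteristic polynomial of the deflated block A = D - ub, and a generic c has n + 1 preimages, one
for each eigenvalue. The area formula thus trades c for u (`lintegral_eigenColumn`). For fixed u and
b, translations trade (a, D) for (z, A). A unitary change of basis sending (1, u) to a multiple of
the first basis vector factors the Gaussian weight, and b integrates out to a factor depending on u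
alone (`exists_lintegral_shear_conj`).

Since |χ(z)|² is the product of |z - w|² over the eigenvalues w of A, it can be absorbed into the
test function. The outcome is a recursion in n (`exists_eigenIntegral_succ`, `deflatedIntegral_eq`),
which the Vandermonde density satisfies as well (`jointIntegral_succ`). Normalising constants are
not computed along the way. -/

namespace Ginibre

/-! ### Area formula for maps with generic fibres of constant cardinality -/

open scoped ENNReal

/-- Area formula for a map all of whose generic fibres have the same cardinality. -/
theorem lintegral_abs_det_mul_comp_of_encard_fiber {E : Type*} [NormedAddCommGroup E]
    [NormedSpace ℝ E] [FiniteDimensional ℝ E] [MeasurableSpace E] [BorelSpace E]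
    (μ : Measure E) [μ.IsAddHaarMeasure] {f : E → E} {f' : E → E →L[ℝ] E}
    (hf : ∀ x, HasStrictFDerivAt f (f' x) x) (hf' : Continuous f') (N : ℕ)
    (hN : ∀ᵐ y ∂μ, (∀ x, f x = y → (f' x).det ≠ 0) → (f ⁻¹' {y}).encard = N)
    (φ : E → ℝ≥0∞) (hφ : Measurable φ) :
    ∫⁻ x, ENNReal.ofReal |(f' x).det| * φ (f x) ∂μ = N * ∫⁻ y, φ y ∂μ := by
  have : CompleteSpace E := FiniteDimensional.complete ℝ E
  have hdet : Continuous fun x => (f' x).det := ContinuousLinearMap.continuous_det.comp hf'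
  set R : Set E := {x | (f' x).det ≠ 0} with hR
  have hRo : IsOpen R := isOpen_ne.preimage hdet
  have hfm : Measurable f := by
    have : Continuous f := continuous_iff_continuousAt.2 fun x => (hf x).continuousAt
    exact this.measurable
  -- local injectivity
  have hloc : ∀ x ∈ R, ∃ U, IsOpen U ∧ x ∈ U ∧ U ⊆ R ∧ Set.InjOn f U := by
    intro x hx
    let e := (f' x).toContinuousLinearEquivOfDetNeZero hx
    have h : HasStrictFDerivAt f (e : E →L[ℝ] E) x := by
      have := hf x
      rwa [← ContinuousLinearMap.coe_toContinuousLinearEquivOfDetNeZero (f' x) hx] at this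
    let O := h.toOpenPartialHomeomorph f
    refine ⟨O.source ∩ R, O.open_source.inter hRo, ⟨h.mem_toOpenPartialHomeomorph_source, hx⟩,
      Set.inter_subset_right, ?_⟩
    have := O.injOn
    exact this.mono Set.inter_subset_left
  choose! U hUo hxU hUR hUi using hloc
  obtain ⟨T, hTR, hTc, hT⟩ : ∃ T ⊆ R, T.Countable ∧ R ⊆ ⋃ x ∈ T, U x :=
    TopologicalSpace.countable_cover_nhdsWithin fun x hx =>
      mem_nhdsWithin_of_mem_nhds ((hUo x hx).mem_nhds (hxU x hx))
  obtain ⟨A, hAm, hAd, hAR, hAi⟩ : ∃ A : ℕ → Set E, (∀ k, MeasurableSet (A k)) ∧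
      Pairwise (Function.onFun Disjoint A) ∧ ⋃ k, A k = R ∧ ∀ k, Set.InjOn f (A k) := by
    rcases T.eq_empty_or_nonempty with rfl | hne
    · have : R = ∅ := by simpa using hT
      exact ⟨fun _ => ∅, by simp, fun i j _ => by simp [Function.onFun], by simp [this], by simp⟩
    · obtain ⟨s, rfl⟩ := hTc.exists_eq_range hne
      have hs : ∀ k, s k ∈ R := fun k => hTR ⟨k, rfl⟩
      refine ⟨disjointed fun k => U (s k), fun k => ?_, disjoint_disjointed _, ?_, fun k => ?_⟩
      · exact MeasurableSet.disjointed (fun k => (hUo _ (hs k)).measurableSet) k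
      · rw [iUnion_disjointed]
        apply Set.Subset.antisymm (Set.iUnion_subset fun k => hUR _ (hs k))
        simpa using hT
      · exact (hUi _ (hs k)).mono (disjointed_subset _ k)
  -- Sard: critical values form a null set, so almost every `y` satisfies the premise in `hN`.
  have hsard : ∀ᵐ y ∂μ, ∀ x, f x = y → (f' x).det ≠ 0 := by
    have : μ (f '' Rᶜ) = 0 := by
      apply addHaar_image_eq_zero_of_det_fderivWithin_eq_zero μ
        (fun x _ => (hf x).hasFDerivAt.hasFDerivWithinAt)
      intro x hx
      simpa [hR] using hx
    filter_upwards [measure_eq_zero_iff_ae_notMem.1 this] with y hy x hxy h0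
    exact hy ⟨x, by simpa [hR] using h0, hxy⟩
  have himg : ∀ k, MeasurableSet (f '' A k) := fun k =>
    (hAm k).image_of_measurable_injOn hfm (hAi k)
  calc ∫⁻ x, ENNReal.ofReal |(f' x).det| * φ (f x) ∂μ
      = ∫⁻ x in R, ENNReal.ofReal |(f' x).det| * φ (f x) ∂μ := by
        rw [← lintegral_indicator hRo.measurableSet]
        refine lintegral_congr fun x => ?_
        by_cases hx : x ∈ R
        · simp [hx]
        · have : (f' x).det = 0 := by simpa [hR] using hx
          simp [hx, this]
    _ = ∑' k, ∫⁻ x in A k, ENNReal.ofReal |(f' x).det| * φ (f x) ∂μ := by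
        rw [← hAR, lintegral_iUnion hAm hAd]
    _ = ∑' k, ∫⁻ y, (f '' A k).indicator φ y ∂μ := by
        congr 1; ext k
        rw [lintegral_indicator (himg k), lintegral_image_eq_lintegral_abs_det_fderiv_mul μ (hAm k)
          (fun x _ => (hf x).hasFDerivAt.hasFDerivWithinAt) (hAi k)]
    _ = ∫⁻ y, ∑' k, (f '' A k).indicator φ y ∂μ := by
        rw [lintegral_tsum fun k => (hφ.indicator (himg k)).aemeasurable]
    _ = ∫⁻ y, N * φ y ∂μ := by
        apply lintegral_congr_ae
        filter_upwards [hsard, hN] with y hy hyN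
        have hcard := hyN hy
        have hmem : ∀ x, f x = y → ∃ k, x ∈ A k := fun x hx => by
          have : x ∈ ⋃ k, A k := hAR ▸ hy x hx
          simpa using this
        have hfin : (f ⁻¹' {y}).Finite := Set.finite_of_encard_eq_coe hcard
        -- Each piece contains at most one preimage of `y`, and each preimage lies in exactly one
        -- piece; the sum over the pieces therefore counts the fibre.
        have h1 : ∀ k, (f '' A k).indicator φ y
            = ∑ x ∈ hfin.toFinset, (A k).indicator (fun _ => φ y) x := by
          intro k
          by_cases hk : y ∈ f '' A k
          · obtain ⟨x, hx, hxy⟩ := hk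
            rw [Set.indicator_of_mem (show y ∈ f '' A k from ⟨x, hx, hxy⟩), Finset.sum_eq_single x]
            · simp [hx]
            · intro z hz hzx
              refine Set.indicator_of_notMem (fun hzA => hzx ?_) _
              exact hAi k hzA hx (by simp at hz; rw [hz, hxy])
            · intro h; simp [hxy] at h
          · rw [Set.indicator_of_notMem hk, Finset.sum_eq_zero]
            intro x hx
            refine Set.indicator_of_notMem (fun hA => hk ⟨x, hA, ?_⟩) _
            simpa using hx
        simp_rw [h1]
        rw [Summable.tsum_finsetSum (fun _ _ => ENNReal.summable)]
        have h2 : ∀ x ∈ hfin.toFinset, ∑' k, (A k).indicator (fun _ => φ y) x = φ y := by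
          intro x hx
          obtain ⟨k, hk⟩ := hmem x (by simpa using hx)
          rw [tsum_eq_single k]
          · simp [hk]
          · intro j hj
            exact Set.indicator_of_notMem (fun h => (hAd hj).le_bot ⟨h, hk⟩) _
        rw [Finset.sum_congr rfl h2, Finset.sum_const, nsmul_eq_mul]
        congr 2
        have := hfin.encard_eq_coe_toFinset_card
        rw [hcard] at this
        exact_mod_cast this.symm
    _ = N * ∫⁻ y, φ y ∂μ := lintegral_const_mul _ hφ

end Ginibre

/-! ### Bordered matrices and deflation of an eigenvector -/

namespace Ginibre

open Matrix Polynomial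

/-- The matrix with first row `(a, b)`, first column `(a, c)` and lower right block `D`. -/
def bordered {ι : Type*} (a : ℂ) (b c : ι → ℂ) (D : Matrix ι ι ℂ) :
    Matrix (Unit ⊕ ι) (Unit ⊕ ι) ℂ :=
  fromBlocks (of fun _ _ => a) (of fun _ j => b j) (of fun i _ => c i) D

/-- No eigenvector of `D` is annihilated by the row `b`. -/
def Observable {ι : Type*} [Fintype ι] (b : ι → ℂ) (D : Matrix ι ι ℂ) : Prop :=
  ∀ (μ : ℂ) (v : ι → ℂ), D *ᵥ v = μ • v → b ⬝ᵥ v = 0 → v = 0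

/-- All the eigenspaces of `D` are at most one-dimensional. -/
def Nonderogatory {ι : Type*} [Fintype ι] (D : Matrix ι ι ℂ) : Prop :=
  ∀ (μ : ℂ) (v w : ι → ℂ), D *ᵥ v = μ • v → D *ᵥ w = μ • w → v ≠ 0 → ∃ s : ℂ, w = s • v

/-- The column `c` for which `(1, u)` is an eigenvector of `bordered a b c D`. -/
def eigenColumn {ι : Type*} [Fintype ι] (a : ℂ) (b : ι → ℂ) (D : Matrix ι ι ℂ) (u : ι → ℂ) :
    ι → ℂ :=
  (a + b ⬝ᵥ u) • u - D *ᵥ u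

/-- The block left after splitting off the eigenvector `(1, u)`. -/
def deflated {ι : Type*} (b : ι → ℂ) (D : Matrix ι ι ℂ) (u : ι → ℂ) : Matrix ι ι ℂ :=
  D - vecMulVec u b

theorem bordered_mulVec {ι : Type*} [Fintype ι] (a : ℂ) (b c : ι → ℂ) (D : Matrix ι ι ℂ) (s : ℂ)
    (u : ι → ℂ) :
    bordered a b c D *ᵥ Sum.elim (fun _ => s) u =
      Sum.elim (fun _ => a * s + b ⬝ᵥ u) (s • c + D *ᵥ u) := by
  rw [bordered, fromBlocks_mulVec]
  ext (i | i) <;> simp [mulVec, dotProduct, mul_comm]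

theorem bordered_mul_bordered {ι : Type*} [Fintype ι] (a a' : ℂ) (b b' c c' : ι → ℂ)
    (D D' : Matrix ι ι ℂ) :
    bordered a b c D * bordered a' b' c' D' =
      bordered (a * a' + b ⬝ᵥ c') (a • b' + b ᵥ* D') (a' • c + D *ᵥ c')
        (vecMulVec c b' + D * D') := by
  simp only [bordered, fromBlocks_multiply]
  congr 1
  · ext; simp [mul_apply, dotProduct]
  · ext; simp [mul_apply, vecMul, dotProduct]
  · ext; simp [mul_apply, mulVec, dotProduct, mul_comm]
  · ext; simp [mul_apply, vecMulVec]

theorem bordered_one {ι : Type*} [DecidableEq ι] :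
    bordered 1 0 0 (1 : Matrix ι ι ℂ) = 1 := by
  rw [bordered, ← fromBlocks_one]
  congr 1

/-- The shear `bordered 1 0 u 1` sends the first basis vector to the eigenvector (1, u), so in the
sheared basis the first column is the eigenvalue followed by zeros. -/
theorem bordered_eigenColumn {ι : Type*} [Fintype ι] [DecidableEq ι] (a : ℂ) (b : ι → ℂ)
    (D : Matrix ι ι ℂ) (u : ι → ℂ) :
    bordered a b (eigenColumn a b D u) D =
      bordered 1 0 u 1 * bordered (a + b ⬝ᵥ u) b 0 (deflated b D u) * bordered 1 0 (-u) 1 := by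
  simp only [bordered_mul_bordered, eigenColumn, deflated]
  congr 1
  · simp
  · simp
  · ext i
    simp [mulVec_neg]
    ring
  · ext i j
    simp [vecMulVec]

theorem bordered_shear_mul_neg {ι : Type*} [Fintype ι] [DecidableEq ι] (u : ι → ℂ) :
    bordered 1 0 u 1 * bordered 1 0 (-u) 1 = 1 := by
  rw [bordered_mul_bordered, ← bordered_one]
  congr 1 <;> simp

theorem charpoly_conj_of_mul_eq_one {ι : Type*} [Fintype ι] [DecidableEq ι] {S T : Matrix ι ι ℂ}
    (h : S * T = 1) (N : Matrix ι ι ℂ) : (S * N * T).charpoly = N.charpoly := by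
  have := charpoly_units_conj ⟨S, T, h, mul_eq_one_comm.1 h⟩ N
  rwa [inv_eq_right_inv h] at this

theorem charpoly_bordered_zero {ι : Type*} [Fintype ι] [DecidableEq ι] (a : ℂ) (b : ι → ℂ)
    (D : Matrix ι ι ℂ) : (bordered a b 0 D).charpoly = (X - C a) * D.charpoly := by
  have : bordered a b 0 D = fromBlocks (of fun _ _ => a) (of fun _ j => b j) 0 D := by
    rw [bordered]; congr 1
  rw [this, charpoly_fromBlocks_zero₂₁]
  congr 1
  simp [charpoly, charmatrix]

theorem charpoly_bordered_eigenColumn {ι : Type*} [Fintype ι] [DecidableEq ι] (a : ℂ) (b : ι → ℂ)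
    (D : Matrix ι ι ℂ) (u : ι → ℂ) :
    (bordered a b (eigenColumn a b D u) D).charpoly =
      (X - C (a + b ⬝ᵥ u)) * (deflated b D u).charpoly := by
  rw [bordered_eigenColumn, ← charpoly_bordered_zero _ b]
  exact charpoly_conj_of_mul_eq_one (bordered_shear_mul_neg u) _

theorem roots_bordered_eigenColumn {ι : Type*} [Fintype ι] [DecidableEq ι] (a : ℂ) (b : ι → ℂ)
    (D : Matrix ι ι ℂ) (u : ι → ℂ) :
    (bordered a b (eigenColumn a b D u) D).charpoly.roots =
      (a + b ⬝ᵥ u) ::ₘ (deflated b D u).charpoly.roots := by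
  rw [charpoly_bordered_eigenColumn, roots_mul, roots_X_sub_C, Multiset.singleton_add]
  exact mul_ne_zero (X_sub_C_ne_zero _) (charpoly_monic _).ne_zero

theorem exists_eigenvector_of_mem_roots {ι : Type*} [Fintype ι] [DecidableEq ι] {M : Matrix ι ι ℂ}
    {z : ℂ} (hz : z ∈ M.charpoly.roots) : ∃ v ≠ 0, M *ᵥ v = z • v := by
  have h := isRoot_of_mem_roots hz
  rw [IsRoot, eval_charpoly, ← exists_mulVec_eq_zero_iff] at h
  obtain ⟨v, hv, h⟩ := h
  refine ⟨v, hv, ?_⟩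
  rw [sub_mulVec, sub_eq_zero] at h
  rw [← h]
  ext i
  simp [scalar_apply, diagonal_apply, mulVec, dotProduct]

theorem mem_roots_of_eigenvector {ι : Type*} [Fintype ι] [DecidableEq ι] {M : Matrix ι ι ℂ}
    {z : ℂ} {v : ι → ℂ} (hv : v ≠ 0) (h : M *ᵥ v = z • v) : z ∈ M.charpoly.roots := by
  rw [mem_roots (charpoly_monic _).ne_zero, IsRoot, eval_charpoly, ← exists_mulVec_eq_zero_iff]
  refine ⟨v, hv, ?_⟩
  rw [sub_mulVec, sub_eq_zero, h]
  ext i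
  simp [scalar_apply, diagonal_apply, mulVec, dotProduct]

/-- Two solutions with the same eigenvalue differ by a vector in an eigenspace of `D` that is
annihilated by `b`. -/
theorem eq_of_eigenColumn_eq {ι : Type*} [Fintype ι] {a : ℂ} {b : ι → ℂ}
    {D : Matrix ι ι ℂ} (hobs : Observable b D) {u w : ι → ℂ}
    (h : eigenColumn a b D u = eigenColumn a b D w) (h' : a + b ⬝ᵥ u = a + b ⬝ᵥ w) : u = w := by
  rw [← sub_eq_zero]
  refine hobs (a + b ⬝ᵥ u) _ ?_ ?_
  · rw [eigenColumn, eigenColumn, ← h'] at h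
    rw [mulVec_sub, smul_sub]
    linear_combination (exp := 1) -h
  · rw [dotProduct_sub]
    linear_combination h'

/-- The map u ↦ a + b·u is a bijection from the fibre to the set of eigenvalues of the bordered
matrix. The hypothesis `hreg` makes these eigenvalues simple, so their number is the size of the
matrix. -/
theorem encard_eigenColumn_fiber {ι : Type*} [Fintype ι] [DecidableEq ι] {a : ℂ} {b : ι → ℂ}
    {D : Matrix ι ι ℂ} (hobs : Observable b D) (c : ι → ℂ)
    (hreg : ∀ u, eigenColumn a b D u = c → (deflated b D u).charpoly.eval (a + b ⬝ᵥ u) ≠ 0) :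
    (eigenColumn a b D ⁻¹' {c}).encard = (Fintype.card ι + 1 : ℕ) := by
  classical
  set M := bordered a b c D with hM
  have hex : ∀ z ∈ M.charpoly.roots, ∃ u, eigenColumn a b D u = c ∧ a + b ⬝ᵥ u = z := by
    intro z hz
    obtain ⟨v, hv, h⟩ := exists_eigenvector_of_mem_roots hz
    obtain ⟨s, w, rfl⟩ : ∃ (s : ℂ) (w : ι → ℂ), v = Sum.elim (fun _ => s) w :=
      ⟨v (Sum.inl ()), v ∘ Sum.inr, by ext (i | i) <;> rfl⟩
    rw [hM, bordered_mulVec] at h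
    have h1 : a * s + b ⬝ᵥ w = z * s := by simpa using congrFun h (Sum.inl ())
    have h2 : s • c + D *ᵥ w = z • w := by
      ext i; simpa using congrFun h (Sum.inr i)
    -- Otherwise the lower part would be an eigenvector of `D` annihilated by `b`. Hence every
    -- eigenvector can be scaled to the form (1, u).
    have hs : s ≠ 0 := by
      rintro rfl
      have : w = 0 := hobs z w (by simpa using h2) (by simpa using h1)
      exact hv (by ext (i | i) <;> simp [this])
    have h3 : a + b ⬝ᵥ (s⁻¹ • w) = z := by
      rw [dotProduct_smul, smul_eq_mul]
      field_simp
      linear_combination h1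
    refine ⟨s⁻¹ • w, ?_, h3⟩
    rw [eigenColumn, h3, mulVec_smul, smul_comm, ← h2, smul_add, smul_smul, inv_mul_cancel₀ hs]
    simp
  have hroots : ∀ u, eigenColumn a b D u = c →
      M.charpoly.roots = (a + b ⬝ᵥ u) ::ₘ (deflated b D u).charpoly.roots := by
    rintro u rfl
    exact roots_bordered_eigenColumn a b D u
  have hnodup : M.charpoly.roots.Nodup := by
    rw [Multiset.nodup_iff_count_le_one]
    intro z
    by_cases hz : z ∈ M.charpoly.roots
    · obtain ⟨u, hu, rfl⟩ := hex z hz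
      have : (deflated b D u).charpoly.roots.count (a + b ⬝ᵥ u) = 0 :=
        Multiset.count_eq_zero.2 fun h => hreg u hu (isRoot_of_mem_roots h)
      rw [hroots u hu, Multiset.count_cons_self, this]
    · rw [Multiset.count_eq_zero.2 hz]; exact zero_le_one
  have himage : (fun u => a + b ⬝ᵥ u) '' (eigenColumn a b D ⁻¹' {c}) =
      (M.charpoly.roots.toFinset : Set ℂ) := by
    ext z
    simp only [Set.mem_image, Set.mem_preimage, Set.mem_singleton_iff, Finset.mem_coe,
      Multiset.mem_toFinset]
    refine ⟨?_, hex z⟩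
    rintro ⟨u, hu, rfl⟩
    rw [hroots u hu]
    exact Multiset.mem_cons_self _ _
  have hinj : Set.InjOn (fun u => a + b ⬝ᵥ u) (eigenColumn a b D ⁻¹' {c}) :=
    fun u hu w hw h => eq_of_eigenColumn_eq hobs (hu.trans hw.symm) h
  rw [← hinj.encard_image, himage, Set.encard_coe_eq_coe_finsetCard,
    Multiset.toFinset_card_of_nodup hnodup, IsAlgClosed.card_roots_eq_natDegree,
    charpoly_natDegree_eq_dim]
  simp [add_comm]

/-- By observability an eigenvector whose first coordinate vanishes is zero, so within an eigenspace
the first coordinate determines the vector. -/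
theorem Nonderogatory.bordered {ι : Type*} [Fintype ι] {a : ℂ} {b c : ι → ℂ}
    {D : Matrix ι ι ℂ} (hobs : Observable b D) : Nonderogatory (bordered a b c D) := by
  intro z v w hv hw hv0
  have key : ∀ v : Unit ⊕ ι → ℂ, Ginibre.bordered a b c D *ᵥ v = z • v → v (Sum.inl ()) = 0 →
      v = 0 := by
    intro v h h0
    obtain ⟨s, w, rfl⟩ : ∃ (s : ℂ) (w : ι → ℂ), v = Sum.elim (fun _ => s) w :=
      ⟨v (Sum.inl ()), v ∘ Sum.inr, by ext (i | i) <;> rfl⟩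
    obtain rfl : s = 0 := h0
    rw [bordered_mulVec] at h
    have h1 : b ⬝ᵥ w = 0 := by simpa using congrFun h (Sum.inl ())
    have h2 : D *ᵥ w = z • w := by
      ext i; simpa using congrFun h (Sum.inr i)
    have : w = 0 := hobs z w h2 h1
    ext (i | i) <;> simp [this]
  have hs : v (Sum.inl ()) ≠ 0 := fun h => hv0 (key v hv h)
  refine ⟨w (Sum.inl ()) / v (Sum.inl ()), ?_⟩
  rw [← sub_eq_zero]
  apply key
  · rw [mulVec_sub, mulVec_smul, hv, hw, smul_sub, smul_comm]
  · simp [hs]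

end Ginibre

/-! ### Measurability of point configurations and of functions of the eigenvalues -/

namespace Ginibre

open Matrix Polynomial

open Classical in
theorem measurable_multiset_of_countP {α β : Type*} [MeasurableSpace α] [MeasurableSpace β]
    {f : β → Multiset α}
    (h : ∀ B : Set α, MeasurableSet B → Measurable fun x => (f x).countP (· ∈ B)) :
    Measurable f := by
  rw [measurable_iff_comap_le, instMeasurableSpaceMultiset, MeasurableSpace.comap_iSup]
  refine iSup_le fun B => ?_
  rw [MeasurableSpace.comap_iSup]
  refine iSup_le fun hB => ?_
  rw [MeasurableSpace.comap_comp]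
  exact (h B hB).comap_le

open Classical in
theorem measurable_countP {α : Type*} [MeasurableSpace α] {B : Set α} (hB : MeasurableSet B) :
    Measurable fun s : Multiset α => s.countP (· ∈ B) := by
  rw [measurable_iff_comap_le]
  exact le_iSup₂_of_le B hB le_rfl

theorem measurable_univ_map {α ι : Type*} [MeasurableSpace α] [Fintype ι] :
    Measurable fun z : ι → α => (Finset.univ : Finset ι).val.map z := by
  classical
  apply measurable_multiset_of_countP
  intro B hB
  have : (fun z : ι → α => ((Finset.univ : Finset ι).val.map z).countP (· ∈ B)) =
      fun z => ∑ i, if z i ∈ B then 1 else 0 := by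
    ext z
    rw [Multiset.countP_map, Finset.sum_boole]
    rfl
  simp only [this]
  exact Finset.measurable_sum _ fun i _ =>
    Measurable.ite (measurable_pi_apply i hB) measurable_const measurable_const

/-- The coefficients below the leading one of the monic polynomial with given roots. -/
noncomputable def coeffsOfRoots (n : ℕ) (z : Fin n → ℂ) (i : Fin n) : ℂ :=
  (∏ j, (X - C (z j))).coeff i

theorem continuous_coeff_prod_X_sub_C {ι : Type*} (s : Finset ι) (k : ℕ) :
    Continuous fun z : ι → ℂ => (∏ j ∈ s, (X - C (z j))).coeff k := by
  classical
  induction s using Finset.induction_on generalizing k with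
  | empty => simpa using continuous_const
  | insert a s ha ih =>
    simp only [Finset.prod_insert ha, sub_mul, coeff_sub, coeff_C_mul]
    refine Continuous.sub ?_ ((continuous_apply a).mul (ih k))
    cases k with
    | zero => simpa using continuous_const
    | succ k => simpa [coeff_X_mul] using ih k

theorem continuous_coeffsOfRoots (n : ℕ) : Continuous (coeffsOfRoots n) :=
  continuous_pi fun _ => continuous_coeff_prod_X_sub_C _ _

/-- The monic polynomial with given coefficients below the leading one. -/
noncomputable def monicOfCoeffs (n : ℕ) (w : Fin n → ℂ) : ℂ[X] :=
  X ^ n + ∑ i : Fin n, C (w i) * X ^ (i : ℕ)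

theorem eq_monicOfCoeffs {n : ℕ} {p : ℂ[X]} (hp : p.Monic) (hn : p.natDegree = n) :
    p = monicOfCoeffs n fun i => p.coeff i := by
  conv_lhs => rw [hp.as_sum, hn]
  rw [monicOfCoeffs, Fin.sum_univ_eq_sum_range (fun i => C (p.coeff i) * X ^ i)]

theorem exists_univ_map_eq {α : Type*} {n : ℕ} (s : Multiset α) (hs : s.card = n) :
    ∃ z : Fin n → α, (Finset.univ : Finset (Fin n)).val.map z = s := by
  obtain ⟨l, rfl⟩ : ∃ l : List α, (l : Multiset α) = s := ⟨s.toList, s.coe_toList⟩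
  rw [Multiset.coe_card] at hs
  subst hs
  exact ⟨l.get, by rw [Fin.univ_val_map, List.ofFn_get]⟩

theorem roots_prod_X_sub_C_fin {n : ℕ} (z : Fin n → ℂ) :
    (∏ j, (X - C (z j))).roots = (Finset.univ : Finset (Fin n)).val.map z := by
  have := roots_multiset_prod_X_sub_C ((Finset.univ : Finset (Fin n)).val.map z)
  rwa [Multiset.map_map] at this

theorem monicOfCoeffs_coeffsOfRoots {n : ℕ} (z : Fin n → ℂ) :
    monicOfCoeffs n (coeffsOfRoots n z) = ∏ j, (X - C (z j)) :=
  (eq_monicOfCoeffs (monic_prod_of_monic _ _ fun j _ => monic_X_sub_C _) (by simp)).symm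

theorem natDegree_monicOfCoeffs {n : ℕ} (w : Fin n → ℂ) :
    (monicOfCoeffs n w).Monic ∧ (monicOfCoeffs n w).natDegree = n := by
  have h : (∑ i : Fin n, C (w i) * X ^ (i : ℕ)).degree < (n : WithBot ℕ) :=
    degree_sum_fin_lt w
  refine ⟨monic_X_pow_add h, ?_⟩
  rw [monicOfCoeffs, add_comm]
  rw [natDegree_add_eq_right_of_degree_lt (by rwa [degree_X_pow]), natDegree_X_pow]

theorem coeff_monicOfCoeffs {n : ℕ} (w : Fin n → ℂ) (i : Fin n) :
    (monicOfCoeffs n w).coeff i = w i := by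
  rw [monicOfCoeffs, coeff_add, coeff_X_pow, if_neg i.2.ne, zero_add, finsetSum_coeff]
  rw [Finset.sum_eq_single i]
  · simp
  · intro j _ hj
    rw [coeff_C_mul, coeff_X_pow, if_neg (fun h => hj (Fin.ext h.symm)), mul_zero]
  · simp

theorem surjective_coeffsOfRoots (n : ℕ) : Function.Surjective (coeffsOfRoots n) := by
  intro w
  obtain ⟨hm, hd⟩ := natDegree_monicOfCoeffs w
  obtain ⟨z, hz⟩ := exists_univ_map_eq (n := n) (monicOfCoeffs n w).roots
    (by rw [IsAlgClosed.card_roots_eq_natDegree, hd])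
  refine ⟨z, ?_⟩
  ext i
  rw [coeffsOfRoots, ← coeff_monicOfCoeffs w i]
  congr 1
  have := (IsAlgClosed.splits (monicOfCoeffs n w)).eq_prod_roots_of_monic hm
  rw [this, ← hz, Multiset.map_map]
  rfl

theorem continuous_coeff_charpoly {ι : Type*} [Fintype ι] [DecidableEq ι] (k : ℕ) :
    Continuous fun A : ι → ι → ℂ => (of A).charpoly.coeff k := by
  have h : ∀ A : ι → ι → ℂ, (of A).charpoly.coeff k =
      MvPolynomial.eval (fun p : ι × ι => A p.1 p.2) ((charpoly.univ ℂ ι).coeff k) := by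
    intro A
    exact (charpoly.univ_coeff_eval₂Hom ι (RingHom.id ℂ) (fun p => A p.1 p.2) k).symm
  simp only [h]
  exact (MvPolynomial.continuous_eval _).comp (by fun_prop)

/-- A symmetric function of the eigenvalues is a measurable function of the matrix as soon as it is
a measurable function of the eigenvalues. -/
theorem measurable_comp_roots_charpoly {n : ℕ} {β : Type*} [MeasurableSpace β]
    {F : Multiset ℂ → β}
    (hF : Measurable fun z : Fin n → ℂ => F ((Finset.univ : Finset (Fin n)).val.map z)) :
    Measurable fun A : Fin n → Fin n → ℂ => F (of A).charpoly.roots := by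
  -- No measurable choice of roots is needed: measurability descends along a measurable surjection
  -- of standard Borel spaces, here the map from roots to coefficients.
  have h1 : Measurable fun w : Fin n → ℂ => F (monicOfCoeffs n w).roots := by
    rw [← (continuous_coeffsOfRoots n).measurable.measurable_comp_iff_of_surjective
      (surjective_coeffsOfRoots n)]
    convert hF using 2 with z
    simp only [Function.comp_apply, monicOfCoeffs_coeffsOfRoots, roots_prod_X_sub_C_fin]
  have h2 : Measurable fun (A : Fin n → Fin n → ℂ) (i : Fin n) => (of A).charpoly.coeff i :=
    measurable_pi_lambda _ fun i => (continuous_coeff_charpoly _).measurable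
  convert h1.comp h2 using 2 with A
  simp only [Function.comp_apply]
  rw [← eq_monicOfCoeffs (charpoly_monic _) (by simp)]

end Ginibre

/-! ### Lebesgue measure on matrices and generic observability -/

namespace Ginibre

open Matrix Polynomial

/-- Lebesgue measure on complex vectors. -/
noncomputable def lebVec (ι : Type*) [Fintype ι] : Measure (ι → ℂ) := Measure.pi fun _ => volume

instance instIsAddHaarMeasureLebVec (ι : Type*) [Fintype ι] : (lebVec ι).IsAddHaarMeasure :=
  Measure.pi.isAddHaarMeasure (μ := fun _ : ι => (volume : Measure ℂ))

/-- Lebesgue measure on complex square matrices. -/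
noncomputable def lebMat (ι : Type*) [Fintype ι] : Measure (ι → ι → ℂ) :=
  Measure.pi fun _ => lebVec ι

instance instIsAddHaarMeasureLebMat (ι : Type*) [Fintype ι] : (lebMat ι).IsAddHaarMeasure :=
  Measure.pi.isAddHaarMeasure (μ := fun _ : ι => lebVec ι)

/-- Failure is witnessed by a unit vector and an eigenvalue in some ball of integer radius. The
complement is thus a countable union of projections of closed sets along compact factors, and such
projections are closed. -/
theorem measurableSet_observable (ι : Type*) [Fintype ι] :
    MeasurableSet {p : (ι → ℂ) × (ι → ι → ℂ) | Observable p.1 (of p.2)} := by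
  let S (k : ℕ) : Set (((ι → ℂ) × (ι → ι → ℂ)) ×
      (Metric.sphere (0 : ι → ℂ) 1 × Metric.closedBall (0 : ℂ) k)) :=
    {q | of q.1.2 *ᵥ q.2.1 = (q.2.2 : ℂ) • (q.2.1 : ι → ℂ) ∧ q.1.1 ⬝ᵥ q.2.1 = 0}
  have hS : ∀ k, IsClosed (S k) := by
    intro k
    refine IsClosed.inter (isClosed_eq ?_ ?_) (isClosed_eq ?_ ?_)
    · refine continuous_pi fun i => continuous_finsetSum _ fun j _ => ?_
      exact ((continuous_apply_apply i j).comp (continuous_snd.comp continuous_fst)).mul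
        ((continuous_apply j).comp (continuous_subtype_val.comp
          (continuous_fst.comp continuous_snd)))
    · fun_prop
    · refine continuous_finsetSum _ fun j _ => ?_
      exact ((continuous_apply j).comp (continuous_fst.comp continuous_fst)).mul
        ((continuous_apply j).comp (continuous_subtype_val.comp
          (continuous_fst.comp continuous_snd)))
    · fun_prop
  have h : {p : (ι → ℂ) × (ι → ι → ℂ) | Observable p.1 (of p.2)}ᶜ = ⋃ k, Prod.fst '' S k := by
    ext ⟨b, D⟩
    simp only [Set.mem_compl_iff, Set.mem_ofPred_eq, Set.mem_iUnion, Set.mem_image]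
    constructor
    · intro h
      simp only [Observable, not_forall] at h
      obtain ⟨z, v, h1, h2, hv⟩ := h
      obtain ⟨k, hk⟩ := exists_nat_ge ‖z‖
      have hn : ‖v‖ ≠ 0 := norm_ne_zero_iff.2 hv
      refine ⟨k, ⟨(b, D), ⟨(‖v‖⁻¹ : ℂ) • v, ?_⟩, ⟨z, by simpa using hk⟩⟩, ⟨?_, ?_⟩, rfl⟩
      · simp [norm_smul, hn]
      · simp only [mulVec_smul, h1]
        rw [smul_comm]
      · simp [h2]
    · rintro ⟨k, ⟨p, ⟨v, hv⟩, ⟨z, hz⟩⟩, ⟨h1, h2⟩, rfl⟩ h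
      have : v = 0 := h z v h1 h2
      simp [this] at hv
  rw [← MeasurableSet.compl_iff, h]
  exact MeasurableSet.iUnion fun k => (isClosedMap_fst_of_compactSpace _ (hS k)).measurableSet

/-- There are finitely many eigenvalues, each with a line of eigenvectors, so the bad `b` lie in a
finite union of proper subspaces. -/
theorem ae_observable {ι : Type*} [Fintype ι] {D : Matrix ι ι ℂ} (hD : Nonderogatory D) :
    ∀ᵐ b ∂lebVec ι, Observable b D := by
  classical
  have hnull : ∀ z : ℂ, lebVec ι
      {b | ∃ v ≠ 0, D *ᵥ v = z • v ∧ b ⬝ᵥ v = 0} = 0 := by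
    intro z
    by_cases hex : ∃ v ≠ 0, D *ᵥ v = z • v
    · obtain ⟨v, hv, h⟩ := hex
      let L : (ι → ℂ) →ₗ[ℝ] ℂ :=
        { toFun := fun b => b ⬝ᵥ v
          map_add' := fun b b' => add_dotProduct b b' v
          map_smul' := fun r b => smul_dotProduct r b v }
      refine measure_mono_null ?_ (Measure.addHaar_submodule (lebVec ι) (LinearMap.ker L) ?_)
      · rintro b ⟨w, hw, hw1, hw2⟩
        obtain ⟨s, rfl⟩ := hD z w v hw1 h hw
        change b ⬝ᵥ (s • w) = 0
        rw [dotProduct_smul, hw2, smul_zero]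
      · intro htop
        obtain ⟨i, hi⟩ := Function.ne_iff.1 hv
        have : Pi.single i (1 : ℂ) ∈ LinearMap.ker L := htop ▸ Submodule.mem_top
        apply hi
        simpa [L] using this
    · convert measure_empty (μ := lebVec ι)
      ext b
      simp only [Set.mem_ofPred_eq, Set.mem_empty_iff_false, iff_false]
      rintro ⟨v, hv, h, -⟩
      exact hex ⟨v, hv, h⟩
  have : ∀ᵐ b ∂lebVec ι, ∀ z ∈ D.charpoly.roots.toFinset,
      ¬ ∃ v ≠ 0, D *ᵥ v = z • v ∧ b ⬝ᵥ v = 0 := by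
    rw [Finset.eventually_all]
    intro z _
    exact measure_eq_zero_iff_ae_notMem.1 (hnull z)
  filter_upwards [this] with b hb z v h1 h2
  by_contra hv
  exact hb z (Multiset.mem_toFinset.2 (mem_roots_of_eigenvector hv h1)) ⟨v, hv, h1, h2⟩

/-- An arbitrary identification of the index types of bordered and of ordinary matrices. -/
noncomputable def borderIndex (n : ℕ) : Unit ⊕ Fin n ≃ Fin (n + 1) :=
  Fintype.equivOfCardEq (by simp [add_comm])

/-- Square matrices of size `n + 1` in terms of the blocks `((b, D), (a, c))`. -/
noncomputable def borderedEquiv (n : ℕ) :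
    (((Fin n → ℂ) × (Fin n → Fin n → ℂ)) × ℂ × (Fin n → ℂ)) ≃ₗ[ℝ] (Fin (n + 1) → Fin (n + 1) → ℂ) where
  toFun x := fun i j => bordered x.2.1 x.1.1 x.2.2 (of x.1.2)
    ((borderIndex n).symm i) ((borderIndex n).symm j)
  map_add' x y := by
    ext i j
    obtain ⟨i, rfl⟩ := (borderIndex n).surjective i
    obtain ⟨j, rfl⟩ := (borderIndex n).surjective j
    rcases i with i | i <;> rcases j with j | j <;> simp [bordered]
  map_smul' r x := by
    ext i j
    obtain ⟨i, rfl⟩ := (borderIndex n).surjective i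
    obtain ⟨j, rfl⟩ := (borderIndex n).surjective j
    rcases i with i | i <;> rcases j with j | j <;> simp [bordered]
  invFun M :=
    ((fun j => M (borderIndex n (Sum.inl ())) (borderIndex n (Sum.inr j)),
      fun i j => M (borderIndex n (Sum.inr i)) (borderIndex n (Sum.inr j))),
      M (borderIndex n (Sum.inl ())) (borderIndex n (Sum.inl ())),
      fun i => M (borderIndex n (Sum.inr i)) (borderIndex n (Sum.inl ())))
  left_inv x := by simp [bordered]
  right_inv M := by
    ext i j
    obtain ⟨i, rfl⟩ := (borderIndex n).surjective i
    obtain ⟨j, rfl⟩ := (borderIndex n).surjective j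
    rcases i with i | i <;> rcases j with j | j <;> simp [bordered]

/-- Lebesgue measure on the blocks `((b, D), (a, c))`. -/
noncomputable def lebBlock (n : ℕ) :
    Measure (((Fin n → ℂ) × (Fin n → Fin n → ℂ)) × ℂ × (Fin n → ℂ)) :=
  ((lebVec (Fin n)).prod (lebMat (Fin n))).prod ((volume : Measure ℂ).prod (lebVec (Fin n)))

instance instIsAddHaarMeasureLebBlock (n : ℕ) : (lebBlock n).IsAddHaarMeasure := by
  have h1 : ((lebVec (Fin n)).prod (lebMat (Fin n))).IsAddHaarMeasure :=
    Measure.prod.instIsAddHaarMeasure _ _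
  have h2 : ((volume : Measure ℂ).prod (lebVec (Fin n))).IsAddHaarMeasure :=
    Measure.prod.instIsAddHaarMeasure _ _
  exact Measure.prod.instIsAddHaarMeasure _ _

theorem of_borderedEquiv (n : ℕ) (a : ℂ) (b c : Fin n → ℂ) (D : Fin n → Fin n → ℂ) :
    of (borderedEquiv n ((b, D), (a, c))) =
      reindex (borderIndex n) (borderIndex n) (bordered a b c (of D)) := rfl

/-- A linear equivalence maps Lebesgue measure to a multiple of Lebesgue measure. -/
theorem exists_map_eq_smul {E F : Type*} [NormedAddCommGroup E] [NormedSpace ℝ E]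
    [FiniteDimensional ℝ E] [MeasurableSpace E] [BorelSpace E] [NormedAddCommGroup F]
    [NormedSpace ℝ F] [FiniteDimensional ℝ F] [MeasurableSpace F] [BorelSpace F]
    (μ : Measure E) [μ.IsAddHaarMeasure] (ν : Measure F) [ν.IsAddHaarMeasure]
    (e : E ≃ₗ[ℝ] F) :
    ∃ κ : ENNReal, κ ≠ 0 ∧ κ ≠ ⊤ ∧ μ.map e = κ • ν := by
  have h : (μ.map e.toContinuousLinearEquiv).IsAddHaarMeasure :=
    e.toContinuousLinearEquiv.isAddHaarMeasure_map μ
  refine ⟨_, ?_, ENNReal.coe_ne_top,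
    Measure.isAddLeftInvariant_eq_smul (μ.map e.toContinuousLinearEquiv) ν⟩
  exact_mod_cast (Measure.addHaarScalarFactor_pos_of_isAddHaarMeasure _ _).ne'

theorem exists_map_borderedEquiv (n : ℕ) : ∃ κ : ENNReal, κ ≠ 0 ∧ κ ≠ ⊤ ∧
    (lebBlock n).map (borderedEquiv n) = κ • lebMat (Fin (n + 1)) :=
  have : BorelSpace (((Fin n → ℂ) × (Fin n → Fin n → ℂ)) × ℂ × (Fin n → ℂ)) := inferInstance
  exists_map_eq_smul (E := ((Fin n → ℂ) × (Fin n → Fin n → ℂ)) × ℂ × (Fin n → ℂ))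
    (F := Fin (n + 1) → Fin (n + 1) → ℂ) (lebBlock n) (lebMat _) (borderedEquiv n)

theorem measurableEmbedding_borderedEquiv (n : ℕ) : MeasurableEmbedding (borderedEquiv n) :=
  (borderedEquiv n).toContinuousLinearEquiv.toHomeomorph.measurableEmbedding

theorem Nonderogatory.reindex {ι κ : Type*} [Fintype ι] [Fintype κ] (σ : ι ≃ κ)
    {D : Matrix ι ι ℂ} (hD : Nonderogatory D) : Nonderogatory (reindex σ σ D) := by
  intro z v w hv hw hv0
  have key : ∀ v, Matrix.reindex σ σ D *ᵥ v = z • v → D *ᵥ (v ∘ σ) = z • (v ∘ σ) := by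
    intro v hv
    ext i
    have := congrFun hv (σ i)
    rw [reindex_apply, submatrix_mulVec_equiv] at this
    simpa using this
  obtain ⟨s, hs⟩ := hD z _ _ (key v hv) (key w hw) (by
    intro h
    apply hv0
    ext i
    simpa using congrFun h (σ.symm i))
  refine ⟨s, ?_⟩
  ext i
  simpa using congrFun hs (σ.symm i)

theorem ae_observable_prod {n : ℕ} (h : ∀ᵐ D ∂lebMat (Fin n), Nonderogatory (of D)) :
    ∀ᵐ p ∂(lebVec (Fin n)).prod (lebMat (Fin n)), Observable p.1 (of p.2) := by
  have h1 : ∀ᵐ D ∂lebMat (Fin n), ∀ᵐ b ∂lebVec (Fin n), Observable b (of D) := by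
    filter_upwards [h] with D hD using ae_observable hD
  have h2 : ∀ᵐ q ∂(lebMat (Fin n)).prod (lebVec (Fin n)), Observable q.2 (of q.1) := by
    rw [Measure.ae_prod_iff_ae_ae]
    · exact h1
    · exact measurable_swap (measurableSet_observable (Fin n))
  rw [← Measure.prod_swap]
  exact (ae_map_iff measurable_swap.aemeasurable (measurableSet_observable (Fin n))).2 h2

/-- The induction alternates two facts: a nonderogatory `D` is observable for almost every row `b`,
and bordering an observable pair gives a nonderogatory matrix for every `a` and `c`. -/
theorem ae_nonderogatory (n : ℕ) : ∀ᵐ D ∂lebMat (Fin n), Nonderogatory (of D) := by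
  induction n with
  | zero =>
    refine Filter.Eventually.of_forall fun D z v w _ _ hv => absurd (Subsingleton.elim v 0) hv
  | succ n ih =>
    obtain ⟨κ, hκ, -, h⟩ := exists_map_borderedEquiv n
    have h1 : ∀ᵐ x ∂lebBlock n, Nonderogatory (of (borderedEquiv n x)) := by
      have := (Measure.quasiMeasurePreserving_fst (μ := (lebVec (Fin n)).prod (lebMat (Fin n)))
        (ν := (volume : Measure ℂ).prod (lebVec (Fin n)))).ae (ae_observable_prod ih)
      filter_upwards [this] with x hx
      exact (Nonderogatory.bordered hx).reindex _
    have h2 : ∀ᵐ M ∂((lebBlock n).map (borderedEquiv n)), Nonderogatory (of M) :=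
      (measurableEmbedding_borderedEquiv n).ae_map_iff.2 h1
    rw [h] at h2
    exact (Measure.ae_ennreal_smul_measure_iff hκ).1 h2

end Ginibre

/-! ### Gaussian densities -/

namespace Ginibre

open Matrix Polynomial
open scoped ENNReal

theorem lintegral_pi_prod {α : Type*} [MeasurableSpace α] (μ : Measure α) [SigmaFinite μ] {n : ℕ}
    (f : Fin n → α → ℝ≥0∞) (hf : ∀ i, Measurable (f i)) :
    ∫⁻ x, ∏ i, f i (x i) ∂Measure.pi (fun _ => μ) = ∏ i, ∫⁻ x, f i x ∂μ := by
  induction n with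
  | zero => simp
  | succ n ih =>
    have h := (measurePreserving_piFinSuccAbove (fun _ : Fin (n + 1) => μ) 0).symm
    rw [← h.lintegral_comp_emb (MeasurableEquiv.measurableEmbedding _)]
    simp only [MeasurableEquiv.piFinSuccAbove_symm_apply, Fin.prod_univ_succ, Fin.insertNthEquiv,
      Fin.insertNth_zero', Equiv.coe_fn_mk, Fin.cons_zero, Fin.cons_succ]
    rw [lintegral_prod_mul (g := fun y : Fin n → α => ∏ i : Fin n, f i.succ (y i))
      (hf 0).aemeasurable, ih _ fun i => hf _]
    exact (Finset.measurable_prod _ fun i _ =>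
      (hf _).comp (measurable_pi_apply i)).aemeasurable

theorem pi_withDensity {α : Type*} [MeasurableSpace α] (μ : Measure α) [SigmaFinite μ] {n : ℕ}
    {ρ : α → ℝ≥0∞} (hρ : Measurable ρ) [SigmaFinite (μ.withDensity ρ)] :
    Measure.pi (fun _ : Fin n => μ.withDensity ρ) =
      (Measure.pi fun _ : Fin n => μ).withDensity fun x => ∏ i, ρ (x i) := by
  refine Measure.pi_eq fun s hs => ?_
  rw [withDensity_apply _ (MeasurableSet.univ_pi hs),
    ← lintegral_indicator (MeasurableSet.univ_pi hs)]
  have : ∀ x : Fin n → α, (Set.univ.pi s).indicator (fun x => ∏ i, ρ (x i)) x =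
      ∏ i, (s i).indicator ρ (x i) := by
    intro x
    by_cases hx : x ∈ Set.univ.pi s
    · rw [Set.indicator_of_mem hx]
      exact Finset.prod_congr rfl fun i _ => (Set.indicator_of_mem (hx i trivial) _).symm
    · rw [Set.indicator_of_notMem hx]
      simp only [Set.mem_pi, Set.mem_univ, true_implies, not_forall] at hx
      obtain ⟨i, hi⟩ := hx
      exact (Finset.prod_eq_zero (Finset.mem_univ i) (Set.indicator_of_notMem hi _)).symm
  simp_rw [this]
  rw [lintegral_pi_prod μ _ fun i => hρ.indicator (hs i)]
  refine Finset.prod_congr rfl fun i _ => ?_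
  rw [withDensity_apply _ (hs i), lintegral_indicator (hs i)]

/-- The unnormalised density of a standard complex Gaussian. -/
noncomputable def gaussDensity (z : ℂ) : ℝ≥0∞ := ENNReal.ofReal (Real.exp (-‖z‖ ^ 2 / 2))

theorem measurable_gaussDensity : Measurable gaussDensity := by
  unfold gaussDensity
  fun_prop

theorem gaussDensity_ne_zero (z : ℂ) : gaussDensity z ≠ 0 := by
  simp [gaussDensity, Real.exp_pos]

theorem complexGaussian_eq_withDensity :
    ∃ c : ℝ≥0∞, c ≠ 0 ∧ c ≠ ⊤ ∧
      complexGaussian = (volume : Measure ℂ).withDensity fun z => c * gaussDensity z := by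
  refine ⟨ENNReal.ofReal ((√(2 * Real.pi))⁻¹ * (√(2 * Real.pi))⁻¹), ?_, ENNReal.ofReal_ne_top, ?_⟩
  · have : 0 < √(2 * Real.pi) := by positivity
    simp only [ne_eq, ENNReal.ofReal_eq_zero, not_le]
    positivity
  · have hmap : complexGaussian = ((gaussianReal 0 1).prod (gaussianReal 0 1)).map
        Complex.measurableEquivRealProd.symm := rfl
    rw [hmap, gaussianReal_of_var_ne_zero _ one_ne_zero,
      prod_withDensity (measurable_gaussianPDF 0 1) (measurable_gaussianPDF 0 1)]
    ext s hs
    have hp := Complex.volume_preserving_equiv_real_prod.symm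
    rw [MeasurableEquiv.map_apply, withDensity_apply _ (Complex.measurableEquivRealProd.symm.measurable hs),
      withDensity_apply _ hs, ← hp.setLIntegral_comp_preimage_emb
        (MeasurableEquiv.measurableEmbedding _)]
    refine lintegral_congr fun p => ?_
    have h1 : ‖Complex.measurableEquivRealProd.symm p‖ ^ 2 = p.1 ^ 2 + p.2 ^ 2 := by
      rw [Complex.sq_norm, Complex.normSq_apply]
      change p.1 * p.1 + p.2 * p.2 = _
      ring
    rw [gaussDensity, h1, gaussianPDF, gaussianPDF, ← ENNReal.ofReal_mul (gaussianPDFReal_nonneg _ _ _),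
      ← ENNReal.ofReal_mul (by positivity)]
    congr 1
    simp only [gaussianPDFReal, NNReal.coe_one, mul_one, sub_zero]
    rw [mul_mul_mul_comm, ← Real.exp_add]
    congr 2
    ring

instance instIsProbabilityMeasureComplexGaussian : IsProbabilityMeasure complexGaussian := by
  have hmap : complexGaussian = ((gaussianReal 0 1).prod (gaussianReal 0 1)).map
    Complex.measurableEquivRealProd.symm := rfl
  rw [hmap]
  exact Measure.isProbabilityMeasure_map (MeasurableEquiv.measurable _).aemeasurable

theorem lintegral_gaussDensity_ne : ∫⁻ z, gaussDensity z ≠ 0 ∧ ∫⁻ z, gaussDensity z ≠ ⊤ := by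
  obtain ⟨c, h0, h1, h⟩ := complexGaussian_eq_withDensity
  have : complexGaussian Set.univ = 1 := measure_univ
  rw [h, withDensity_apply _ MeasurableSet.univ, Measure.restrict_univ,
    lintegral_const_mul _ measurable_gaussDensity] at this
  constructor
  · intro h; simp [h] at this
  · intro h; simp [h, h0] at this

/-- The unnormalised density of a complex Ginibre matrix. -/
noncomputable def matDensity {ι : Type*} [Fintype ι] (M : Matrix ι ι ℂ) : ℝ≥0∞ :=
  ∏ i, ∏ j, gaussDensity (M i j)

theorem measurable_matDensity {ι : Type*} [Fintype ι] :
    Measurable fun A : ι → ι → ℂ => matDensity (of A) := by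
  unfold matDensity
  refine Finset.measurable_prod _ fun i _ => Finset.measurable_prod _ fun j _ => ?_
  exact measurable_gaussDensity.comp ((measurable_pi_apply j).comp (measurable_pi_apply i))

theorem lintegral_matDensity_ne (n : ℕ) :
    ∫⁻ A, matDensity (of A) ∂lebMat (Fin n) ≠ 0 ∧ ∫⁻ A, matDensity (of A) ∂lebMat (Fin n) ≠ ⊤ := by
  have h : ∫⁻ A, matDensity (of A) ∂lebMat (Fin n) =
      ∏ _i : Fin n, ∏ _j : Fin n, ∫⁻ z, gaussDensity z := by
    simp only [matDensity, lebMat, of_apply]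
    rw [lintegral_pi_prod (lebVec (Fin n)) (fun _ x => ∏ j, gaussDensity (x j)) fun i =>
      Finset.measurable_prod _ fun j _ => measurable_gaussDensity.comp (measurable_pi_apply j)]
    refine Finset.prod_congr rfl fun i _ => ?_
    exact lintegral_pi_prod volume (fun _ => gaussDensity) fun _ => measurable_gaussDensity
  rw [h]
  exact ⟨Finset.prod_ne_zero_iff.2 fun _ _ => Finset.prod_ne_zero_iff.2 fun _ _ =>
    lintegral_gaussDensity_ne.1, ENNReal.prod_ne_top fun _ _ => ENNReal.prod_ne_top fun _ _ =>
    lintegral_gaussDensity_ne.2⟩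

theorem IsGinibre.exists_map_eq {Ω : Type*} [MeasurableSpace Ω] {P : Measure Ω}
    [IsProbabilityMeasure P] {n : ℕ} {M : Ω → Matrix (Fin n) (Fin n) ℂ} (hM : IsGinibre M P) :
    ∃ c : ℝ≥0∞, P.map (fun ω i j => M ω i j) =
      (lebMat (Fin n)).withDensity fun A => c * matDensity (of A) := by
  obtain ⟨c, h0, h1, h⟩ := complexGaussian_eq_withDensity
  have hρ : Measurable fun z => c * gaussDensity z := measurable_gaussDensity.const_mul c
  have hmeas : ∀ p : Fin n × Fin n, AEMeasurable (fun ω => M ω p.1 p.2) P :=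
    fun p => (hM.entry_law p.1 p.2).aemeasurable
  have hflat : P.map (fun ω (p : Fin n × Fin n) => M ω p.1 p.2) =
      Measure.pi fun _ => complexGaussian := by
    rw [hM.entry_indep.map_fun_eq_pi_map hmeas]
    congr 1
    ext p : 1
    exact (hM.entry_law p.1 p.2).map_eq
  have hcurry : Measurable fun (x : Fin n × Fin n → ℂ) i j => x (i, j) := by fun_prop
  have huncurry : Measurable fun (A : Fin n → Fin n → ℂ) (p : Fin n × Fin n) => A p.1 p.2 :=
    measurable_pi_lambda _ fun p => (measurable_pi_apply p.2).comp (measurable_pi_apply p.1)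
  have hnested : (Measure.pi fun _ : Fin n => Measure.pi fun _ : Fin n => complexGaussian).map
      (fun (A : Fin n → Fin n → ℂ) (p : Fin n × Fin n) => A p.1 p.2) =
        Measure.pi fun _ => complexGaussian := by
    refine (Measure.pi_eq fun s hs => ?_).symm
    rw [Measure.map_apply huncurry (MeasurableSet.univ_pi hs)]
    have : (fun (A : Fin n → Fin n → ℂ) (p : Fin n × Fin n) => A p.1 p.2) ⁻¹' (Set.univ.pi s) =
        Set.univ.pi fun i => Set.univ.pi fun j => s (i, j) := by
      ext A; simp [Set.mem_pi]
    rw [this, Measure.pi_pi, Fintype.prod_prod_type]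
    simp_rw [Measure.pi_pi]
  have hM' : P.map (fun ω i j => M ω i j) =
      Measure.pi fun _ : Fin n => Measure.pi fun _ : Fin n => complexGaussian := by
    have h3 : (P.map (fun ω (p : Fin n × Fin n) => M ω p.1 p.2)).map
        (fun (x : Fin n × Fin n → ℂ) i j => x (i, j)) = P.map (fun ω i j => M ω i j) :=
      AEMeasurable.map_map_of_aemeasurable hcurry.aemeasurable (aemeasurable_pi_lambda _ hmeas)
    rw [← h3, hflat, ← hnested, Measure.map_map hcurry huncurry]
    exact Measure.map_id
  have : SigmaFinite ((volume : Measure ℂ).withDensity fun z => c * gaussDensity z) :=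
    h ▸ inferInstance
  have hvec : (Measure.pi fun _ : Fin n => complexGaussian) =
      (lebVec (Fin n)).withDensity fun x => ∏ j, (c * gaussDensity (x j)) := by
    rw [h, pi_withDensity _ hρ]; rfl
  have : SigmaFinite ((lebVec (Fin n)).withDensity fun x => ∏ j, (c * gaussDensity (x j))) :=
    hvec ▸ inferInstance
  refine ⟨∏ _i : Fin n, ∏ _j : Fin n, c, ?_⟩
  have hm : Measurable fun x : Fin n → ℂ => ∏ j, (c * gaussDensity (x j)) :=
    Finset.measurable_prod _ fun j _ => hρ.comp (measurable_pi_apply j)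
  rw [hM', hvec, pi_withDensity _ hm]
  simp only [matDensity, Finset.prod_mul_distrib, of_apply]
  rfl

end Ginibre

/-! ### Jacobian of the column substitution and unitary invariance -/

namespace Ginibre

open Matrix Polynomial
open scoped ENNReal

theorem det_restrictScalars_toLin' {ι : Type*} [Fintype ι] [DecidableEq ι] (N : Matrix ι ι ℂ) :
    |LinearMap.det ((toLin' N).restrictScalars ℝ)| = ‖N.det‖ ^ 2 := by
  rw [LinearMap.det_restrictScalars, Algebra.norm_complex_apply, LinearMap.det_toLin',
    Complex.normSq_eq_norm_sq, abs_of_nonneg (by positivity)]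

/-- The derivative of u ↦ c at u is multiplication by z - (D - ub) with z = a + b·u. Its determinant
over ℝ is the squared modulus of the complex one, namely of the deflated characteristic polynomial
at z. Regular values of the map are therefore those covered by `encard_eigenColumn_fiber`. -/
theorem lintegral_eigenColumn {ι : Type*} [Fintype ι] [DecidableEq ι] {b : ι → ℂ}
    {D : Matrix ι ι ℂ} (hobs : Observable b D) (a : ℂ) {φ : (ι → ℂ) → ℝ≥0∞} (hφ : Measurable φ) :
    ∫⁻ u, ENNReal.ofReal (‖(deflated b D u).charpoly.eval (a + b ⬝ᵥ u)‖ ^ 2) *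
        φ (eigenColumn a b D u) ∂lebVec ι =
      (Fintype.card ι + 1 : ℕ) * ∫⁻ c, φ c ∂lebVec ι := by
  let Lb : (ι → ℂ) →L[ℝ] ℂ := LinearMap.toContinuousLinearMap
    { toFun := fun u => b ⬝ᵥ u
      map_add' := dotProduct_add b
      map_smul' := fun r u => dotProduct_smul r b u }
  let LD : (ι → ℂ) →L[ℝ] (ι → ℂ) := LinearMap.toContinuousLinearMap
    ((toLin' D).restrictScalars ℝ)
  have hf : eigenColumn a b D = fun u => (a + Lb u) • u - LD u := by
    ext u : 1
    simp [eigenColumn, Lb, LD]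
  have hcd : ContDiff ℝ 1 (eigenColumn a b D) := by
    rw [hf]
    exact ((contDiff_const.add Lb.contDiff).smul contDiff_id).sub LD.contDiff
  have hderiv : ∀ u, HasFDerivAt (eigenColumn a b D)
      ((a + Lb u) • ContinuousLinearMap.id ℝ (ι → ℂ) + Lb.smulRight u - LD) u := by
    intro u
    rw [hf]
    exact ((Lb.hasFDerivAt.const_add a).smul (hasFDerivAt_id u)).sub LD.hasFDerivAt
  have hdet : ∀ u, |(fderiv ℝ (eigenColumn a b D) u).det| =
      ‖(deflated b D u).charpoly.eval (a + b ⬝ᵥ u)‖ ^ 2 := by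
    intro u
    rw [eval_charpoly, ← det_restrictScalars_toLin', (hderiv u).fderiv, ContinuousLinearMap.det]
    congr 2
    refine LinearMap.ext fun v => ?_
    change (a + b ⬝ᵥ u) • v + (b ⬝ᵥ v) • u - D *ᵥ v =
      (scalar ι (a + b ⬝ᵥ u) - (D - vecMulVec u b)) *ᵥ v
    have h1 : scalar ι (a + b ⬝ᵥ u) *ᵥ v = (a + b ⬝ᵥ u) • v := by
      ext i
      simp [scalar_apply, mulVec_diagonal]
    rw [sub_mulVec, sub_mulVec, vecMulVec_mulVec, h1]
    simp only [op_smul_eq_smul]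
    abel
  simp only [← hdet]
  apply lintegral_abs_det_mul_comp_of_encard_fiber (lebVec ι)
    (fun x => hcd.contDiffAt.hasStrictFDerivAt one_ne_zero) (hcd.continuous_fderiv one_ne_zero) _ _ _ hφ
  refine Filter.Eventually.of_forall fun c hc => encard_eigenColumn_fiber hobs c fun u hu h0 => ?_
  apply hc u hu
  rw [← abs_eq_zero, hdet, h0]
  simp

/-- Complete the normalised vector (1, u) to an orthonormal basis and take the conjugated basis
vectors as rows. -/
theorem exists_unitary_annihilating {ι : Type*} [Fintype ι] [DecidableEq ι] (u : ι → ℂ) :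
    ∃ Q : Matrix (Unit ⊕ ι) (Unit ⊕ ι) ℂ, Qᴴ * Q = 1 ∧
      ∀ i, (Q *ᵥ Sum.elim (fun _ => 1) u) (Sum.inr i) = 0 := by
  let v : EuclideanSpace ℂ (Unit ⊕ ι) := WithLp.toLp 2 (Sum.elim (fun _ => 1) u)
  have hv : v ≠ 0 := by
    intro h
    have : v (Sum.inl ()) = 0 := by rw [h]; rfl
    simp [v] at this
  have hvn : (‖v‖ : ℂ) ≠ 0 := by simpa using hv
  have hcard : Module.finrank ℂ (EuclideanSpace ℂ (Unit ⊕ ι)) = Fintype.card (Unit ⊕ ι) :=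
    finrank_euclideanSpace
  obtain ⟨e, he⟩ := Orthonormal.exists_orthonormalBasis_extension_of_card_eq (𝕜 := ℂ) hcard
    (v := fun _ => (‖v‖⁻¹ : ℂ) • v) (s := {Sum.inl ()}) (by
      constructor
      · intro i
        simp [norm_smul, hv]
      · intro i j hij
        exact absurd (Subsingleton.elim i j) hij)
  have he0 : e (Sum.inl ()) = (‖v‖⁻¹ : ℂ) • v := he _ rfl
  let Q : Matrix (Unit ⊕ ι) (Unit ⊕ ι) ℂ := of fun i j => star (e i j)
  refine ⟨Q, ?_, ?_⟩
  · rw [mul_eq_one_comm]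
    ext i k
    have h1 : (Q * Qᴴ) i k = inner ℂ (e i) (e k) := by
      simp [Q, mul_apply, PiLp.inner_apply, mul_comm]
    rw [h1, orthonormal_iff_ite.1 e.orthonormal, one_apply]
  · intro i
    have h1 : (Q *ᵥ Sum.elim (fun _ => 1) u) (Sum.inr i) = inner ℂ (e (Sum.inr i)) v := by
      simp only [Q, mulVec, dotProduct, PiLp.inner_apply, of_apply]
      refine Finset.sum_congr rfl fun j _ => ?_
      simp [v, mul_comm]
    have h2 : v = (‖v‖ : ℂ) • e (Sum.inl ()) := by
      rw [he0, smul_smul, mul_inv_cancel₀ hvn, one_smul]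
    rw [h1, h2, inner_smul_right, orthonormal_iff_ite.1 e.orthonormal]
    simp

/-- The density depends only on the Frobenius norm, which is what makes it invariant under unitary
conjugation. -/
theorem matDensity_eq {ι : Type*} [Fintype ι] (M : Matrix ι ι ℂ) :
    matDensity M = ENNReal.ofReal (Real.exp (-(trace (M * Mᴴ)).re / 2)) := by
  have h : (trace (M * Mᴴ)).re = ∑ i, ∑ j, ‖M i j‖ ^ 2 := by
    simp only [trace, diag_apply, mul_apply, Complex.re_sum, conjTranspose_apply]
    refine Finset.sum_congr rfl fun i _ => Finset.sum_congr rfl fun j _ => ?_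
    rw [Complex.sq_norm, Complex.normSq_apply]
    simp
  rw [h, ← Finset.sum_neg_distrib, Finset.sum_div, Real.exp_sum,
    ENNReal.ofReal_prod_of_nonneg fun _ _ => (Real.exp_pos _).le]
  refine Finset.prod_congr rfl fun i _ => ?_
  rw [← Finset.sum_neg_distrib, Finset.sum_div, Real.exp_sum,
    ENNReal.ofReal_prod_of_nonneg fun _ _ => (Real.exp_pos _).le]
  rfl

theorem matDensity_unitary_conj {ι : Type*} [Fintype ι] [DecidableEq ι] {Q : Matrix ι ι ℂ}
    (hQ : Qᴴ * Q = 1) (M : Matrix ι ι ℂ) : matDensity (Q * M * Qᴴ) = matDensity M := by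
  rw [matDensity_eq, matDensity_eq]
  have : Q * M * Qᴴ * (Q * M * Qᴴ)ᴴ = Q * (M * Mᴴ) * Qᴴ := by
    simp only [conjTranspose_mul, conjTranspose_conjTranspose]
    calc Q * M * Qᴴ * (Q * (Mᴴ * Qᴴ)) = Q * M * (Qᴴ * Q) * Mᴴ * Qᴴ := by
          simp only [Matrix.mul_assoc]
      _ = _ := by rw [hQ]; simp only [Matrix.mul_assoc, Matrix.one_mul]
  rw [this, trace_mul_cycle, hQ, Matrix.one_mul]

theorem gaussDensity_zero : gaussDensity 0 = 1 := by simp [gaussDensity]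

theorem matDensity_bordered_zero {ι : Type*} [Fintype ι] (a : ℂ) (b : ι → ℂ) (D : Matrix ι ι ℂ) :
    matDensity (bordered a b 0 D) = gaussDensity a * (∏ j, gaussDensity (b j)) * matDensity D := by
  simp [matDensity, bordered, Fintype.prod_sum_type, gaussDensity_zero]

theorem matDensity_reindex {ι κ : Type*} [Fintype ι] [Fintype κ] (σ : ι ≃ κ) (M : Matrix ι ι ℂ) :
    matDensity (reindex σ σ M) = matDensity M := by
  simp only [matDensity, reindex_apply, submatrix_apply]
  rw [← σ.prod_comp]
  refine Finset.prod_congr rfl fun i _ => ?_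
  rw [← σ.prod_comp]
  simp

/-- After a unitary change of basis that makes `(1, u)` the first basis vector (up to scaling), the
entries of a bordered matrix with eigenvector `(1, u)` become independent of each other. -/
theorem exists_matDensity_shear_conj {ι : Type*} [Fintype ι] [DecidableEq ι] (u : ι → ℂ) :
    ∃ (S T : Matrix ι ι ℂ) (r : ℂ), S * T = 1 ∧ ∀ (z : ℂ) (A : Matrix ι ι ℂ), ∃ b₀ : ι → ℂ,
      ∀ b : ι → ℂ, matDensity (bordered 1 0 u 1 * bordered z b 0 A * bordered 1 0 (-u) 1) =
        gaussDensity z * (∏ j, gaussDensity ((r • ((b + b₀) ᵥ* T)) j)) *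
          matDensity (S * A * T) := by
  obtain ⟨Q, hQ, hQu⟩ := exists_unitary_annihilating u
  have hdecomp : ∀ R : Matrix (Unit ⊕ ι) (Unit ⊕ ι) ℂ, ∃ r x y S, R = bordered r x y S :=
    fun R => ⟨R (Sum.inl ()) (Sum.inl ()), fun j => R (Sum.inl ()) (Sum.inr j),
      fun i => R (Sum.inr i) (Sum.inl ()), of fun i j => R (Sum.inr i) (Sum.inr j), by
        ext (i | i) (j | j) <;> rfl⟩
  have hext : ∀ {r x y S r' x' y' S'}, bordered (ι := ι) r x y S = bordered r' x' y' S' →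
      r = r' ∧ x = x' ∧ y = y' ∧ S = S' := by
    intro r x y S r' x' y' S' h
    obtain ⟨h1, h2, h3, h4⟩ := fromBlocks_inj.1 h
    exact ⟨congrFun (congrFun h1 ()) (), congrFun h2 (),
      funext fun i => congrFun (congrFun h3 i) (), h4⟩
  obtain ⟨r, x, y, S, hR⟩ := hdecomp (Q * bordered 1 0 u 1)
  obtain ⟨r', x', y', T, hR'⟩ := hdecomp (bordered 1 0 (-u) 1 * Qᴴ)
  have h1 : (Q * bordered 1 0 u 1) * (bordered 1 0 (-u) 1 * Qᴴ) = 1 := by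
    rw [Matrix.mul_assoc, ← Matrix.mul_assoc (bordered 1 0 u 1), bordered_shear_mul_neg,
      Matrix.one_mul]
    exact mul_eq_one_comm.1 hQ
  -- The first column of `Q * bordered 1 0 u 1` is `Q` applied to (1, u), whose lower coordinates
  -- vanish. Thus this product and its inverse are block upper triangular.
  have hy : y = 0 := by
    have h2 : (Q * bordered 1 0 u 1) *ᵥ Sum.elim (fun _ => 1) 0 = Q *ᵥ Sum.elim (fun _ => 1) u := by
      rw [← mulVec_mulVec, bordered_mulVec]
      simp
    rw [hR, bordered_mulVec] at h2
    ext i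
    have := congrFun h2 (Sum.inr i)
    rw [hQu] at this
    simpa using this
  subst hy
  have h3 := mul_eq_one_comm.1 h1
  rw [hR, hR', bordered_mul_bordered, ← bordered_one] at h1 h3
  obtain ⟨h1a, h1b, h1c, h1d⟩ := hext h1
  obtain ⟨h3a, h3b, h3c, h3d⟩ := hext h3
  have hr : r' * r = 1 := by simpa using h3a
  have hr0 : r ≠ 0 := right_ne_zero_of_mul_eq_one hr
  have hy' : y' = 0 := by
    have : r • y' = 0 := by simpa using h3c
    exact (smul_eq_zero.1 this).resolve_left hr0
  subst hy'
  have hST : S * T = 1 := by simpa using h1d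
  refine ⟨S, T, r, hST, fun z A => ?_⟩
  -- The upper right block of the triple product is r bT + xAT + rz x'. Factoring out r and T, with
  -- r' = 1/r and ST = 1, gives this shift.
  refine ⟨r' • ((x ᵥ* A + (r * z) • (x' ᵥ* S))), fun b => ?_⟩
  have h4 : matDensity (bordered 1 0 u 1 * bordered z b 0 A * bordered 1 0 (-u) 1) =
      matDensity (bordered r x 0 S * bordered z b 0 A * bordered r' x' 0 T) := by
    rw [← matDensity_unitary_conj hQ, ← hR, ← hR']
    simp only [Matrix.mul_assoc]
  rw [h4, bordered_mul_bordered, bordered_mul_bordered]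
  have h5 : ∀ a b c D a' b' D', a = a' → b = b' → c = 0 → D = D' →
      matDensity (bordered (ι := ι) a b c D) =
        gaussDensity a' * (∏ j, gaussDensity (b' j)) * matDensity D' := by
    rintro a b c D a' b' D' rfl rfl rfl rfl
    exact matDensity_bordered_zero _ _ _
  apply h5
  · simp only [dotProduct_zero, add_zero]
    linear_combination z * hr
  · simp only [dotProduct_zero, add_zero, add_vecMul, smul_vecMul, smul_add, smul_smul,
      vecMul_vecMul, hST, vecMul_one]
    rw [show r * (r' * (r * z)) = r * z by linear_combination r * z * hr,
      show r * r' = 1 by linear_combination hr, one_smul]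
    abel
  · simp
  · simp

end Ginibre

/-! ### Eigenvalue integrals and integrating out the row -/

namespace Ginibre

open Matrix Polynomial
open scoped ENNReal

/-- The product of `g` over the eigenvalues of `M`. -/
noncomputable def rootProd {ι : Type*} [Fintype ι] [DecidableEq ι] (g : ℂ → ℝ≥0∞)
    (M : Matrix ι ι ℂ) : ℝ≥0∞ :=
  (M.charpoly.roots.map g).prod

theorem measurable_rootProd {n : ℕ} {g : ℂ → ℝ≥0∞} (hg : Measurable g) :
    Measurable fun A : Fin n → Fin n → ℂ => rootProd g (of A) := by
  refine measurable_comp_roots_charpoly (F := fun s => (s.map g).prod) ?_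
  simp only [Multiset.map_map]
  exact Finset.measurable_prod _ fun i _ => hg.comp (measurable_pi_apply i)

/-- The unnormalised expectation of the product of `g` over the eigenvalues of a Ginibre matrix. -/
noncomputable def eigenIntegral (n : ℕ) (g : ℂ → ℝ≥0∞) : ℝ≥0∞ :=
  ∫⁻ A, rootProd g (of A) * matDensity (of A) ∂lebMat (Fin n)

theorem eigenIntegral_one (n : ℕ) :
    eigenIntegral n (fun _ => 1) ≠ 0 ∧ eigenIntegral n (fun _ => 1) ≠ ⊤ := by
  have : eigenIntegral n (fun _ => 1) = ∫⁻ A, matDensity (of A) ∂lebMat (Fin n) := by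
    simp [eigenIntegral, rootProd]
  rw [this]
  exact lintegral_matDensity_ne n

/-- The linear automorphism `A ↦ S * A * T` of the space of matrices. -/
noncomputable def mulMulEquiv {ι : Type*} [Fintype ι] [DecidableEq ι] {S T : Matrix ι ι ℂ}
    (h : S * T = 1) : (ι → ι → ℂ) ≃ₗ[ℝ] (ι → ι → ℂ) where
  toFun A := of.symm (S * of A * T)
  invFun A := of.symm (T * of A * S)
  map_add' A B := by
    change of.symm (S * (of A + of B) * T) = of.symm (S * of A * T + S * of B * T)
    rw [Matrix.mul_add, Matrix.add_mul]
  map_smul' r A := by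
    change of.symm (S * (r • of A) * T) = of.symm (r • (S * of A * T))
    rw [Matrix.mul_smul, Matrix.smul_mul]
  left_inv A := by
    have h' := mul_eq_one_comm.1 h
    simp only [Equiv.apply_symm_apply]
    rw [show T * (S * of A * T) * S = (T * S) * of A * (T * S) by simp only [Matrix.mul_assoc], h']
    simp
  right_inv A := by
    simp only [Equiv.apply_symm_apply]
    rw [show S * (T * of A * S) * T = (S * T) * of A * (S * T) by simp only [Matrix.mul_assoc], h]
    simp

/-- Translation invariance removes the shift of `b`, leaving an integral that depends on `u` alone;
conjugation of `A` is then undone by a linear substitution, under which `J` is invariant. Finiteness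
of the factor is not needed here. -/
theorem exists_lintegral_shear_conj {ι : Type*} [Fintype ι] [DecidableEq ι] (u : ι → ℂ) :
    ∃ c : ℝ≥0∞, c ≠ 0 ∧ ∀ J : ℂ → Matrix ι ι ℂ → ℝ≥0∞,
      (Measurable fun p : ℂ × (ι → ι → ℂ) => J p.1 (of p.2)) →
      (∀ z A S T, S * T = 1 → J z (S * A * T) = J z A) →
      ∫⁻ A, ∫⁻ z, ∫⁻ b, J z (of A) *
        matDensity (bordered 1 0 u 1 * bordered z b 0 (of A) * bordered 1 0 (-u) 1)
          ∂lebVec ι ∂volume ∂lebMat ι =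
        c * ∫⁻ A, ∫⁻ z, J z (of A) * (gaussDensity z * matDensity (of A)) ∂volume ∂lebMat ι := by
  obtain ⟨S, T, r, hST, h⟩ := exists_matDensity_shear_conj u
  obtain ⟨κ, hκ0, -, hκ⟩ := exists_map_eq_smul (lebMat ι) (lebMat ι) (mulMulEquiv hST)
  let ψ : (ι → ℂ) → ℝ≥0∞ := fun b => ∏ j, gaussDensity ((r • (b ᵥ* T)) j)
  have hψm : Measurable ψ := by
    refine Finset.measurable_prod _ fun j _ => measurable_gaussDensity.comp ?_
    have : Continuous fun b : ι → ℂ => (r • (b ᵥ* T)) j := by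
      simp only [Pi.smul_apply, vecMul, dotProduct]
      fun_prop
    exact this.measurable
  set c₁ := ∫⁻ b, ψ b ∂lebVec ι with hc₁
  have hc₁0 : c₁ ≠ 0 := by
    rw [hc₁, Ne, lintegral_eq_zero_iff hψm]
    intro h0
    obtain ⟨b, hb⟩ := h0.exists
    exact Finset.prod_ne_zero_iff.2 (fun j _ => gaussDensity_ne_zero _) hb
  refine ⟨c₁ * κ, mul_ne_zero hc₁0 hκ0, fun J hJ hJc => ?_⟩
  have hinner : ∀ z A, ∫⁻ b, J z A *
      matDensity (bordered 1 0 u 1 * bordered z b 0 A * bordered 1 0 (-u) 1) ∂lebVec ι =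
        c₁ * (J z (S * A * T) * (gaussDensity z * matDensity (S * A * T))) := by
    intro z A
    obtain ⟨b₀, hb₀⟩ := h z A
    have : ∀ b, J z A * matDensity (bordered 1 0 u 1 * bordered z b 0 A * bordered 1 0 (-u) 1) =
        J z A * (gaussDensity z * matDensity (S * A * T)) * ψ (b + b₀) := by
      intro b; rw [hb₀]; ring
    simp_rw [this]
    rw [lintegral_const_mul (f := fun b => ψ (b + b₀)) _ (hψm.comp (measurable_add_const b₀)),
      lintegral_add_right_eq_self ψ b₀, hJc z A S T hST, mul_comm]
  have hF : Measurable fun p : (ι → ι → ℂ) × ℂ =>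
      J p.2 (of p.1) * (gaussDensity p.2 * matDensity (of p.1)) :=
    (hJ.comp measurable_swap).mul ((measurable_gaussDensity.comp measurable_snd).mul
      (measurable_matDensity.comp measurable_fst))
  have hemb : MeasurableEmbedding (mulMulEquiv hST) :=
    (mulMulEquiv hST).toContinuousLinearEquiv.toHomeomorph.measurableEmbedding
  have hF' : Measurable fun p : (ι → ι → ℂ) × ℂ => J p.2 (S * of p.1 * T) *
      (gaussDensity p.2 * matDensity (S * of p.1 * T)) := hF.comp ((hemb.measurable.comp measurable_fst).prodMk measurable_snd)
  simp_rw [hinner]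
  calc ∫⁻ A, ∫⁻ z, c₁ * (J z (S * of A * T) * (gaussDensity z * matDensity (S * of A * T))) ∂volume ∂lebMat ι
      = c₁ * ∫⁻ A, ∫⁻ z, J z (S * of A * T) *
          (gaussDensity z * matDensity (S * of A * T)) ∂volume ∂lebMat ι := by
        rw [← lintegral_const_mul _ hF'.lintegral_prod_right']
        refine lintegral_congr fun A => ?_
        exact lintegral_const_mul _ (hF'.comp measurable_prodMk_left)
    _ = c₁ * ∫⁻ A, ∫⁻ z, J z (of A) * (gaussDensity z * matDensity (of A))
          ∂volume ∂((lebMat ι).map (mulMulEquiv hST)) := by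
        rw [hemb.lintegral_map]
        rfl
    _ = _ := by rw [hκ, lintegral_smul_measure, smul_eq_mul, mul_assoc]

theorem lintegral_translate {ι : Type*} [Fintype ι] (u : ι → ℂ)
    {K : (ι → ℂ) → ℂ → (ι → ι → ℂ) → ℝ≥0∞}
    (hK : Measurable fun p : (ι → ℂ) × ℂ × (ι → ι → ℂ) => K p.1 p.2.1 p.2.2) :
    ∫⁻ b, ∫⁻ D, ∫⁻ a, K b (a + b ⬝ᵥ u) (D - fun i j => u i * b j) ∂volume ∂lebMat ι ∂lebVec ι =
      ∫⁻ A, ∫⁻ z, ∫⁻ b, K b z A ∂lebVec ι ∂volume ∂lebMat ι := by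
  have h1 : ∀ b, ∫⁻ D, ∫⁻ a, K b (a + b ⬝ᵥ u) (D - fun i j => u i * b j) ∂volume ∂lebMat ι =
      ∫⁻ A, ∫⁻ z, K b z A ∂volume ∂lebMat ι := by
    intro b
    simp_rw [fun D => lintegral_add_right_eq_self (μ := (volume : Measure ℂ)) (fun a => K b a D) (b ⬝ᵥ u)]
    exact lintegral_sub_right_eq_self (μ := lebMat ι) (fun D => ∫⁻ a, K b a D) _
  simp_rw [h1]
  have h2 : Measurable fun p : ((ι → ℂ) × (ι → ι → ℂ)) × ℂ => K p.1.1 p.2 p.1.2 :=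
    hK.comp (by fun_prop : Measurable fun p : ((ι → ℂ) × (ι → ι → ℂ)) × ℂ => (p.1.1, p.2, p.1.2))
  rw [lintegral_lintegral_swap (h2.lintegral_prod_right').aemeasurable]
  refine lintegral_congr fun A => ?_
  rw [lintegral_lintegral_swap]
  exact (hK.comp (by fun_prop : Measurable fun p : (ι → ℂ) × ℂ => (p.1, p.2, A))).aemeasurable

/-- The integrand of the deflated integral. -/
noncomputable def deflatedProd {ι : Type*} [Fintype ι] [DecidableEq ι] (g : ℂ → ℝ≥0∞) (z : ℂ)
    (A : Matrix ι ι ℂ) : ℝ≥0∞ :=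
  ENNReal.ofReal (‖A.charpoly.eval z‖ ^ 2) * (g z * rootProd g A)

theorem measurable_deflatedProd {n : ℕ} {g : ℂ → ℝ≥0∞} (hg : Measurable g) :
    Measurable fun p : ℂ × (Fin n → Fin n → ℂ) => deflatedProd g p.1 (of p.2) := by
  refine Measurable.mul ?_ ((hg.comp measurable_fst).mul
    ((measurable_rootProd hg).comp measurable_snd))
  have : Continuous fun p : ℂ × (Fin n → Fin n → ℂ) =>
      (scalar (Fin n) p.1 - of p.2).det := by
    refine Continuous.matrix_det ?_
    refine Continuous.sub ?_ continuous_snd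
    exact Continuous.matrix_diagonal (continuous_pi fun _ => continuous_fst)
  simp only [eval_charpoly]
  exact (this.norm.pow 2).measurable.ennreal_ofReal

theorem deflatedProd_conj {ι : Type*} [Fintype ι] [DecidableEq ι] (g : ℂ → ℝ≥0∞) (z : ℂ)
    (A S T : Matrix ι ι ℂ) (h : S * T = 1) : deflatedProd g z (S * A * T) = deflatedProd g z A := by
  simp only [deflatedProd, rootProd, charpoly_conj_of_mul_eq_one h]

theorem rootProd_bordered_eigenColumn {ι : Type*} [Fintype ι] [DecidableEq ι] (g : ℂ → ℝ≥0∞)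
    (a : ℂ) (b : ι → ℂ) (D : Matrix ι ι ℂ) (u : ι → ℂ) :
    rootProd g (bordered a b (eigenColumn a b D u) D) =
      g (a + b ⬝ᵥ u) * rootProd g (deflated b D u) := by
  rw [rootProd, roots_bordered_eigenColumn, Multiset.map_cons, Multiset.prod_cons, rootProd]

theorem rootProd_reindex {ι κ : Type*} [Fintype ι] [DecidableEq ι] [Fintype κ] [DecidableEq κ]
    (g : ℂ → ℝ≥0∞) (σ : ι ≃ κ) (M : Matrix ι ι ℂ) :
    rootProd g (reindex σ σ M) = rootProd g M := by
  rw [rootProd, charpoly_reindex, rootProd]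

/-- The unnormalised expectation after splitting off one eigenvalue. -/
noncomputable def deflatedIntegral (n : ℕ) (g : ℂ → ℝ≥0∞) : ℝ≥0∞ :=
  ∫⁻ A, ∫⁻ z, deflatedProd g z (of A) * (gaussDensity z * matDensity (of A)) ∂volume ∂lebMat (Fin n)

theorem continuous_shear_conj (ι : Type*) [Fintype ι] [DecidableEq ι] :
    Continuous fun p : (ι → ℂ) × (ι → ℂ) × ℂ × (ι → ι → ℂ) =>
      bordered 1 0 p.1 1 * bordered p.2.2.1 p.2.1 0 (of p.2.2.2) * bordered 1 0 (-p.1) 1 := by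
  have hb : ∀ {X : Type _} [TopologicalSpace X] {a : X → ℂ} {b c : X → ι → ℂ}
      {D : X → Matrix ι ι ℂ}, Continuous a → Continuous b → Continuous c → Continuous D →
      Continuous fun x => bordered (a x) (b x) (c x) (D x) := by
    intro X _ a b c D ha hb hc hD
    refine Continuous.matrix_fromBlocks ?_ ?_ ?_ hD
    · exact continuous_matrix fun _ _ => ha
    · exact continuous_matrix fun _ j => (continuous_apply j).comp hb
    · exact continuous_matrix fun i _ => (continuous_apply i).comp hc
  refine Continuous.matrix_mul (Continuous.matrix_mul ?_ ?_) ?_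
  · exact hb continuous_const continuous_const continuous_fst continuous_const
  · exact hb (by fun_prop) (by fun_prop) continuous_const
      (continuous_snd.comp (continuous_snd.comp continuous_snd))
  · exact hb continuous_const continuous_const continuous_fst.neg continuous_const

end Ginibre

/-! ### Recursion for the eigenvalue integral -/

namespace Ginibre

open Matrix Polynomial
open scoped ENNReal

/-- The integrand of the eigenvalue integral in the coordinates `(u, b, z, A)`. -/
noncomputable def shearIntegrand {n : ℕ} (g : ℂ → ℝ≥0∞) (u b : Fin n → ℂ) (z : ℂ)
    (A : Fin n → Fin n → ℂ) : ℝ≥0∞ :=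
  deflatedProd g z (of A) *
    matDensity (bordered 1 0 u 1 * bordered z b 0 (of A) * bordered 1 0 (-u) 1)

theorem measurable_shearIntegrand {n : ℕ} {g : ℂ → ℝ≥0∞} (hg : Measurable g) :
    Measurable fun p : (Fin n → ℂ) × (Fin n → ℂ) × ℂ × (Fin n → Fin n → ℂ) =>
      shearIntegrand g p.1 p.2.1 p.2.2.1 p.2.2.2 := by
  refine Measurable.mul ((measurable_deflatedProd hg).comp
    (measurable_snd.comp measurable_snd)) ?_
  have : Continuous fun p : (Fin n → ℂ) × (Fin n → ℂ) × ℂ × (Fin n → Fin n → ℂ) =>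
      of.symm (bordered 1 0 p.1 1 * bordered p.2.2.1 p.2.1 0 (of p.2.2.2) * bordered 1 0 (-p.1) 1) :=
    continuous_shear_conj (Fin n)
  exact measurable_matDensity.comp this.measurable

theorem of_sub_mul {ι : Type*} (u b : ι → ℂ) (D : ι → ι → ℂ) :
    of (D - fun i j => u i * b j) = deflated b (of D) u := rfl

/-- This is the substitution of u for c. The spectrum becomes z together with that of the deflated
block, and the Jacobian is the squared factor in `deflatedProd`. -/
theorem mul_lintegral_column {n : ℕ} {g : ℂ → ℝ≥0∞} (hg : Measurable g) {b : Fin n → ℂ}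
    {D : Fin n → Fin n → ℂ} (hobs : Observable b (of D)) (a : ℂ) :
    (n + 1 : ℕ) * ∫⁻ c, rootProd g (of (borderedEquiv n ((b, D), (a, c)))) *
        matDensity (of (borderedEquiv n ((b, D), (a, c)))) ∂lebVec (Fin n) =
      ∫⁻ u, shearIntegrand g u b (a + b ⬝ᵥ u) (D - fun i j => u i * b j) ∂lebVec (Fin n) := by
  have hm : Measurable fun c => rootProd g (of (borderedEquiv n ((b, D), (a, c)))) *
        matDensity (of (borderedEquiv n ((b, D), (a, c)))) :=
    ((measurable_rootProd hg).mul measurable_matDensity).comp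
      ((measurableEmbedding_borderedEquiv n).measurable.comp
        (by fun_prop : Measurable fun c : Fin n → ℂ => ((b, D), (a, c))))
  have h := lintegral_eigenColumn hobs a hm
  rw [Fintype.card_fin] at h
  rw [← h]
  refine lintegral_congr fun u => ?_
  simp only [of_borderedEquiv, rootProd_reindex, matDensity_reindex,
    rootProd_bordered_eigenColumn, shearIntegrand, deflatedProd, of_sub_mul]
  rw [bordered_eigenColumn]
  ring

/-- `shearIntegrand` in terms of the blocks of the original matrix. -/
noncomputable def columnIntegrand {n : ℕ} (g : ℂ → ℝ≥0∞) (u b : Fin n → ℂ)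
    (D : Fin n → Fin n → ℂ) (a : ℂ) : ℝ≥0∞ :=
  shearIntegrand g u b (a + b ⬝ᵥ u) (D - fun i j => u i * b j)

theorem measurable_columnIntegrand {n : ℕ} {g : ℂ → ℝ≥0∞} (hg : Measurable g) :
    Measurable fun p : (((Fin n → ℂ) × (Fin n → ℂ)) × (Fin n → Fin n → ℂ)) × ℂ =>
      columnIntegrand g p.1.1.1 p.1.1.2 p.1.2 p.2 := by
  have hcont : Continuous fun p : (((Fin n → ℂ) × (Fin n → ℂ)) × (Fin n → Fin n → ℂ)) × ℂ =>
      (p.1.1.1, p.1.1.2, p.2 + p.1.1.2 ⬝ᵥ p.1.1.1,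
        p.1.2 - fun i j => p.1.1.1 i * p.1.1.2 j) := by
    simp only [dotProduct]
    fun_prop
  have := (measurable_shearIntegrand (n := n) hg).comp hcont.measurable
  simpa only [Function.comp_def, columnIntegrand] using this

theorem lintegral_columnIntegrand {n : ℕ} {g : ℂ → ℝ≥0∞} (hg : Measurable g) (u : Fin n → ℂ) :
    ∫⁻ b, ∫⁻ D, ∫⁻ a, columnIntegrand g u b D a ∂volume ∂lebMat (Fin n) ∂lebVec (Fin n) =
      ∫⁻ A, ∫⁻ z, ∫⁻ b, shearIntegrand g u b z A ∂lebVec (Fin n) ∂volume ∂lebMat (Fin n) := by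
  have h1 : Measurable fun q : (Fin n → ℂ) × ℂ × (Fin n → Fin n → ℂ) => (u, q) := by fun_prop
  have h2 := (measurable_shearIntegrand (n := n) hg).comp h1
  simp only [Function.comp_def] at h2
  exact lintegral_translate u (K := shearIntegrand g u) h2

theorem lintegral_columnIntegrand_swap {n : ℕ} {g : ℂ → ℝ≥0∞} (hg : Measurable g) :
    ∫⁻ p, ∫⁻ a, ∫⁻ u, columnIntegrand g u p.1 p.2 a ∂lebVec (Fin n) ∂volume
        ∂(lebVec (Fin n)).prod (lebMat (Fin n)) =
      ∫⁻ u, ∫⁻ b, ∫⁻ D, ∫⁻ a, columnIntegrand g u b D a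
        ∂volume ∂lebMat (Fin n) ∂lebVec (Fin n) ∂lebVec (Fin n) := by
  have hT := measurable_columnIntegrand (n := n) hg
  have e1 : ∀ p : (Fin n → ℂ) × (Fin n → Fin n → ℂ),
      ∫⁻ a, ∫⁻ u, columnIntegrand g u p.1 p.2 a ∂lebVec (Fin n) ∂volume =
      ∫⁻ u, ∫⁻ a, columnIntegrand g u p.1 p.2 a ∂volume ∂lebVec (Fin n) := by
    intro p
    have h1 : Measurable fun q : ℂ × (Fin n → ℂ) => (((q.2, p.1), p.2), q.1) := by fun_prop
    exact lintegral_lintegral_swap (hT.comp h1).aemeasurable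
  simp_rw [e1]
  have hm3 := hT.lintegral_prod_right' (ν := volume)
  have h2 : Measurable fun q : ((Fin n → ℂ) × (Fin n → Fin n → ℂ)) × (Fin n → ℂ) =>
      ((q.2, q.1.1), q.1.2) := by fun_prop
  rw [lintegral_lintegral_swap (f := fun (p : (Fin n → ℂ) × (Fin n → Fin n → ℂ)) u =>
    ∫⁻ a, columnIntegrand g u p.1 p.2 a) (hm3.comp h2).aemeasurable]
  refine lintegral_congr fun u => ?_
  have h3 : Measurable fun q : (Fin n → ℂ) × (Fin n → Fin n → ℂ) => ((u, q.1), q.2) := by fun_prop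
  exact lintegral_prod _ (hm3.comp h3).aemeasurable

theorem mul_eigenIntegral_succ (n : ℕ) {κ : ℝ≥0∞}
    (hκ : (lebBlock n).map (borderedEquiv n) = κ • lebMat (Fin (n + 1))) {g : ℂ → ℝ≥0∞}
    (hg : Measurable g) :
    (n + 1 : ℕ) * (κ * eigenIntegral (n + 1) g) =
      ∫⁻ p, ∫⁻ a, ∫⁻ u, columnIntegrand g u p.1 p.2 a ∂lebVec (Fin n) ∂volume
        ∂(lebVec (Fin n)).prod (lebMat (Fin n)) := by
  let G : (Fin (n + 1) → Fin (n + 1) → ℂ) → ℝ≥0∞ := fun A => rootProd g (of A) * matDensity (of A)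
  have hG : Measurable G := (measurable_rootProd hg).mul measurable_matDensity
  have hGE : Measurable fun x => G (borderedEquiv n x) :=
    hG.comp (measurableEmbedding_borderedEquiv n).measurable
  have h1 : κ * eigenIntegral (n + 1) g = ∫⁻ x, G (borderedEquiv n x) ∂lebBlock n := by
    rw [← (measurableEmbedding_borderedEquiv n).lintegral_map, hκ, lintegral_smul_measure]
    rfl
  have hs : Measurable fun q : (((Fin n → ℂ) × (Fin n → Fin n → ℂ)) × ℂ) × (Fin n → ℂ) =>
      (q.1.1, (q.1.2, q.2)) := by fun_prop
  have hm1 := hGE.comp hs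
  simp only [Function.comp_def] at hm1
  have hm2 := hm1.lintegral_prod_right' (ν := lebVec (Fin n))
  have h2 : ∫⁻ x, G (borderedEquiv n x) ∂lebBlock n =
      ∫⁻ p, ∫⁻ a, ∫⁻ c, G (borderedEquiv n (p, (a, c))) ∂lebVec (Fin n) ∂volume
        ∂(lebVec (Fin n)).prod (lebMat (Fin n)) := by
    rw [lebBlock, lintegral_prod _ hGE.aemeasurable]
    refine lintegral_congr fun p => ?_
    have hs' : Measurable fun q : ℂ × (Fin n → ℂ) => (p, q) := by fun_prop
    exact lintegral_prod _ (hGE.comp hs').aemeasurable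
  rw [h1, h2, ← lintegral_const_mul _ hm2.lintegral_prod_right']
  refine lintegral_congr_ae ?_
  filter_upwards [ae_observable_prod (ae_nonderogatory n)] with p hp
  have hs' : Measurable fun a : ℂ => (p, a) := by fun_prop
  have hm3 := hm2.comp hs'
  simp only [Function.comp_def] at hm3
  rw [← lintegral_const_mul _ hm3]
  exact lintegral_congr fun a => mul_lintegral_column hg hp a

/-- The factor `c` is chosen pointwise in `u`, so measurability is asserted only for its product
with the deflated integral, which is an iterated integral of a measurable function. -/
theorem exists_mul_eigenIntegral_succ (n : ℕ) : ∃ (κ : ℝ≥0∞) (c : (Fin n → ℂ) → ℝ≥0∞), κ ≠ 0 ∧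
    κ ≠ ⊤ ∧ (∀ u, c u ≠ 0) ∧ ∀ g : ℂ → ℝ≥0∞, Measurable g →
      (Measurable fun u => c u * deflatedIntegral n g) ∧
      κ * eigenIntegral (n + 1) g = ∫⁻ u, c u * deflatedIntegral n g ∂lebVec (Fin n) := by
  obtain ⟨κ, hκ0, hκt, hκ⟩ := exists_map_borderedEquiv n
  choose c hc0 hc using fun u : Fin n → ℂ => exists_lintegral_shear_conj u
  refine ⟨(n + 1 : ℕ) * κ, c, mul_ne_zero (by simp) hκ0,
    ENNReal.mul_ne_top (ENNReal.natCast_ne_top _) hκt, hc0, fun g hg => ?_⟩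
  have hinner : ∀ u : Fin n → ℂ, c u * deflatedIntegral n g =
      ∫⁻ b, ∫⁻ D, ∫⁻ a, columnIntegrand g u b D a ∂volume ∂lebMat (Fin n) ∂lebVec (Fin n) := by
    intro u
    rw [lintegral_columnIntegrand hg]
    exact (hc u (deflatedProd g) (measurable_deflatedProd hg) (deflatedProd_conj g)).symm
  simp_rw [hinner]
  refine ⟨((measurable_columnIntegrand hg).lintegral_prod_right'.lintegral_prod_right').lintegral_prod_right', ?_⟩
  rw [mul_assoc, mul_eigenIntegral_succ n hκ hg, lintegral_columnIntegrand_swap hg]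

theorem rootProd_mul {ι : Type*} [Fintype ι] [DecidableEq ι] (g h : ℂ → ℝ≥0∞) (M : Matrix ι ι ℂ) :
    rootProd (fun w => g w * h w) M = rootProd g M * rootProd h M :=
  Multiset.prod_map_mul

/-- This turns the Jacobian into a product over eigenvalues, so that it can be merged with the test
function and the recursion closes. -/
theorem rootProd_sq_dist {ι : Type*} [Fintype ι] [DecidableEq ι] (z : ℂ) (M : Matrix ι ι ℂ) :
    rootProd (fun w => ENNReal.ofReal (‖z - w‖ ^ 2)) M =
      ENNReal.ofReal (‖M.charpoly.eval z‖ ^ 2) := by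
  have h := (IsAlgClosed.splits M.charpoly).eq_prod_roots_of_monic (charpoly_monic M)
  rw [rootProd]
  conv_rhs => rw [h, eval_multiset_prod, Multiset.map_map]
  generalize M.charpoly.roots = s
  induction s using Multiset.induction_on with
  | empty => simp
  | cons a s ih =>
    rw [Multiset.map_cons, Multiset.prod_cons, ih, Multiset.map_cons, Multiset.prod_cons, norm_mul,
      mul_pow, ENNReal.ofReal_mul (by positivity)]
    simp

theorem deflatedIntegral_eq {n : ℕ} {g : ℂ → ℝ≥0∞} (hg : Measurable g) :
    deflatedIntegral n g = ∫⁻ z, g z * gaussDensity z *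
      eigenIntegral n (fun w => g w * ENNReal.ofReal (‖z - w‖ ^ 2)) := by
  have hm : Measurable fun p : (Fin n → Fin n → ℂ) × ℂ =>
      deflatedProd g p.2 (of p.1) * (gaussDensity p.2 * matDensity (of p.1)) :=
    ((measurable_deflatedProd hg).comp measurable_swap).mul
      ((measurable_gaussDensity.comp measurable_snd).mul
        (measurable_matDensity.comp measurable_fst))
  rw [deflatedIntegral, lintegral_lintegral_swap hm.aemeasurable]
  refine lintegral_congr fun z => ?_
  have hg' : Measurable fun w => g w * ENNReal.ofReal (‖z - w‖ ^ 2) := by fun_prop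
  have hm' : Measurable fun A : Fin n → Fin n → ℂ =>
      rootProd (fun w => g w * ENNReal.ofReal (‖z - w‖ ^ 2)) (of A) * matDensity (of A) :=
    (measurable_rootProd hg').mul measurable_matDensity
  rw [eigenIntegral, ← lintegral_const_mul _ hm']
  refine lintegral_congr fun A => ?_
  rw [rootProd_mul, rootProd_sq_dist, deflatedProd]
  ring

theorem exists_eigenIntegral_succ (n : ℕ) : ∃ C : ℝ≥0∞, ∀ g : ℂ → ℝ≥0∞, Measurable g →
    eigenIntegral (n + 1) g = C * deflatedIntegral n g := by
  obtain ⟨κ, c, hκ0, hκt, hc0, h⟩ := exists_mul_eigenIntegral_succ n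
  -- For g = 1 the left side is positive and finite, which forces the deflated integral `d` to be so
  -- too; dividing by `d` then shows that `c` is measurable.
  obtain ⟨hm, h1⟩ := h (fun _ => 1) measurable_const
  obtain ⟨hI0, hIt⟩ := eigenIntegral_one (n + 1)
  set d := deflatedIntegral n (fun _ => 1)
  have hd0 : d ≠ 0 := by
    intro h0
    simp only [h0, mul_zero, lintegral_zero] at h1
    exact mul_ne_zero hκ0 hI0 h1
  have hdt : d ≠ ⊤ := by
    intro ht
    simp only [ht, ENNReal.mul_top (hc0 _), lintegral_const] at h1
    rw [ENNReal.top_mul (by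
      rw [Ne, Measure.measure_univ_eq_zero]; exact NeZero.ne _)] at h1
    exact ENNReal.mul_ne_top hκt hIt h1
  have hcm : Measurable c := by
    have : c = fun u => c u * d * d⁻¹ := by
      ext u
      rw [mul_assoc, ENNReal.mul_inv_cancel hd0 hdt, mul_one]
    rw [this]
    exact hm.mul_const _
  refine ⟨κ⁻¹ * ∫⁻ u, c u ∂lebVec (Fin n), fun g hg => ?_⟩
  rw [mul_assoc, ← lintegral_mul_const _ hcm, ← (h g hg).2, ← mul_assoc,
    ENNReal.inv_mul_cancel hκ0 hκt, one_mul]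

end Ginibre

/-! ### Joint density of the eigenvalues -/

namespace Ginibre

open Matrix Polynomial
open scoped ENNReal

/-- The squared modulus of the Vandermonde determinant. -/
noncomputable def sqVandermonde {n : ℕ} (z : Fin n → ℂ) : ℝ≥0∞ :=
  ∏ i, ∏ j ∈ Finset.Ioi i, ENNReal.ofReal (‖z j - z i‖ ^ 2)

theorem measurable_sqVandermonde (n : ℕ) : Measurable (sqVandermonde (n := n)) := by
  unfold sqVandermonde
  fun_prop

/-- The integral against the unnormalised joint density of the eigenvalues. -/
noncomputable def jointIntegral (n : ℕ) (g : ℂ → ℝ≥0∞) : ℝ≥0∞ :=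
  ∫⁻ z, (∏ i, (g (z i) * gaussDensity (z i))) * sqVandermonde z ∂lebVec (Fin n)

theorem sqVandermonde_cons {n : ℕ} (w : ℂ) (z : Fin n → ℂ) :
    sqVandermonde (Fin.cons w z : Fin (n + 1) → ℂ) =
      (∏ i, ENNReal.ofReal (‖w - z i‖ ^ 2)) * sqVandermonde z := by
  simp only [sqVandermonde, Fin.prod_univ_succ, Fin.prod_Ioi_zero, Fin.prod_Ioi_succ, Fin.cons_zero,
    Fin.cons_succ, norm_sub_rev]

theorem measurable_jointIntegrand {n : ℕ} {g : ℂ → ℝ≥0∞} (hg : Measurable g) :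
    Measurable fun z : Fin n → ℂ => (∏ i, (g (z i) * gaussDensity (z i))) * sqVandermonde z := by
  refine Measurable.mul (Finset.measurable_prod _ fun i _ => ?_) (measurable_sqVandermonde n)
  exact (hg.comp (measurable_pi_apply i)).mul (measurable_gaussDensity.comp (measurable_pi_apply i))

theorem jointIntegral_succ (n : ℕ) {g : ℂ → ℝ≥0∞} (hg : Measurable g) :
    (Measurable fun w => jointIntegral n (fun z => g z * ENNReal.ofReal (‖w - z‖ ^ 2))) ∧
    jointIntegral (n + 1) g = ∫⁻ w, g w * gaussDensity w *
      jointIntegral n (fun z => g z * ENNReal.ofReal (‖w - z‖ ^ 2)) := by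
  have hm : Measurable fun p : ℂ × (Fin n → ℂ) => (∏ i, (g (p.2 i) *
      ENNReal.ofReal (‖p.1 - p.2 i‖ ^ 2) * gaussDensity (p.2 i))) * sqVandermonde p.2 := by
    refine Measurable.mul (Finset.measurable_prod _ fun i _ => ?_)
      ((measurable_sqVandermonde n).comp measurable_snd)
    have h1 : Measurable fun p : ℂ × (Fin n → ℂ) => p.2 i := by fun_prop
    exact ((hg.comp h1).mul (by fun_prop)).mul (measurable_gaussDensity.comp h1)
  refine ⟨hm.lintegral_prod_right', ?_⟩
  have h := (measurePreserving_piFinSuccAbove (fun _ : Fin (n + 1) => (volume : Measure ℂ)) 0).symm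
  rw [jointIntegral, lebVec, ← h.lintegral_comp_emb (MeasurableEquiv.measurableEmbedding _),
    lintegral_prod]
  · refine lintegral_congr fun w => ?_
    rw [jointIntegral, ← lintegral_const_mul]
    · refine lintegral_congr fun z => ?_
      have : (MeasurableEquiv.piFinSuccAbove (fun _ : Fin (n + 1) => ℂ) 0).symm (w, z) =
          (Fin.cons w z : Fin (n + 1) → ℂ) := by
        simp [MeasurableEquiv.piFinSuccAbove_symm_apply, Fin.insertNthEquiv]
      rw [this, sqVandermonde_cons, Fin.prod_univ_succ]
      simp only [Fin.cons_zero, Fin.cons_succ, Finset.prod_mul_distrib]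
      ring
    · have h1 : Measurable fun z : Fin n → ℂ => (w, z) := by fun_prop
      exact hm.comp h1
  · exact ((measurable_jointIntegrand hg).comp (MeasurableEquiv.measurable _)).aemeasurable

/-- Both sides obey the same recursion up to a constant. The constant must be uniform in g, because
the inductive step applies the hypothesis to g multiplied by |z - ·|², for every z. -/
theorem exists_eigenIntegral_eq (n : ℕ) : ∃ C : ℝ≥0∞, ∀ g : ℂ → ℝ≥0∞, Measurable g →
    eigenIntegral n g = C * jointIntegral n g := by
  induction n with
  | zero =>
    refine ⟨1, fun g _ => ?_⟩
    simp [eigenIntegral, jointIntegral, rootProd, matDensity, lebMat, lebVec, sqVandermonde]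
  | succ n ih =>
    obtain ⟨C, hC⟩ := ih
    obtain ⟨C', hC'⟩ := exists_eigenIntegral_succ n
    refine ⟨C' * C, fun g hg => ?_⟩
    obtain ⟨hm, hj⟩ := jointIntegral_succ n hg
    have hm' : Measurable fun w => g w * gaussDensity w *
        jointIntegral n (fun z => g z * ENNReal.ofReal (‖w - z‖ ^ 2)) :=
      (hg.mul measurable_gaussDensity).mul hm
    rw [hC' g hg, deflatedIntegral_eq hg, hj, mul_assoc, ← lintegral_const_mul _ hm']
    congr 1
    refine lintegral_congr fun z => ?_
    have hg' : Measurable fun w => g w * ENNReal.ofReal (‖z - w‖ ^ 2) := by fun_prop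
    rw [hC _ hg']
    ring

end Ginibre

/-! ### Radial weights and orthogonality of powers -/

namespace Ginibre

open Matrix Polynomial
open scoped ENNReal ComplexConjugate

/-- The Gaussian weight with an additional radial factor. -/
noncomputable def radialWeight (f : ℝ → ℝ) (z : ℂ) : ℝ := f ‖z‖ * Real.exp (-‖z‖ ^ 2 / 2)

/-- The moments of a radial weight. -/
noncomputable def radialMoment (f : ℝ → ℝ) (k : ℕ) : ℝ≥0∞ :=
  ∫⁻ z : ℂ, ENNReal.ofReal (radialWeight f z * ‖z‖ ^ (2 * k))

theorem integrable_pow_mul_exp (k : ℕ) :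
    Integrable fun z : ℂ => ‖z‖ ^ k * Real.exp (-‖z‖ ^ 2 / 2) := by
  have h := Complex.integral_rpow_mul_exp_neg_mul_rpow (p := 2) (q := k) (b := 1 / 2)
    one_le_two (by have : (0 : ℝ) ≤ k := Nat.cast_nonneg k; linarith) (by norm_num)
  have h2 : (fun z : ℂ => ‖z‖ ^ (k : ℝ) * Real.exp (-(1 / 2) * ‖z‖ ^ (2 : ℝ))) =
      fun z : ℂ => ‖z‖ ^ k * Real.exp (-‖z‖ ^ 2 / 2) := by
    ext z
    rw [Real.rpow_natCast, show (2 : ℝ) = ((2 : ℕ) : ℝ) by norm_num, Real.rpow_natCast]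
    congr 2
    push_cast
    ring
  rw [h2] at h
  -- The integral of a non-integrable function is 0 by convention, so a nonzero value proves
  -- integrability.
  apply Integrable.of_integral_ne_zero
  rw [h]
  have hk : (0 : ℝ) < ((k : ℝ) + 2) / 2 := by positivity
  have := Real.Gamma_pos_of_pos hk
  positivity

theorem radialWeight_nonneg {f : ℝ → ℝ} (h0 : ∀ x, 0 ≤ f x) (z : ℂ) : 0 ≤ radialWeight f z :=
  mul_nonneg (h0 _) (Real.exp_pos _).le

theorem measurable_radialWeight {f : ℝ → ℝ} (hf : Measurable f) : Measurable (radialWeight f) := by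
  unfold radialWeight
  fun_prop

theorem integrable_radialWeight_mul {f : ℝ → ℝ} (hf : Measurable f) (h0 : ∀ x, 0 ≤ f x)
    (h1 : ∀ x, f x ≤ 1) (a b : ℕ) :
    Integrable fun z : ℂ => (radialWeight f z : ℂ) * (z ^ a * conj z ^ b) := by
  refine (integrable_pow_mul_exp (a + b)).mono' ?_ (Filter.Eventually.of_forall fun z => ?_)
  · have := measurable_radialWeight hf
    have hc : Measurable fun z : ℂ => conj z := Complex.continuous_conj.measurable
    exact Measurable.aestronglyMeasurable (by fun_prop)
  · rw [norm_mul, norm_mul, norm_pow, norm_pow, RCLike.norm_conj, Complex.norm_real, Real.norm_eq_abs,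
      abs_of_nonneg (radialWeight_nonneg h0 z), ← pow_add, mul_comm, radialWeight]
    have : f ‖z‖ * Real.exp (-‖z‖ ^ 2 / 2) ≤ 1 * Real.exp (-‖z‖ ^ 2 / 2) := by
      gcongr; exact h1 _
    rw [one_mul] at this
    gcongr

theorem integral_radialWeight_mul_of_ne {f : ℝ → ℝ} {a b : ℕ} (hab : a ≠ b) :
    ∫ z : ℂ, (radialWeight f z : ℂ) * (z ^ a * conj z ^ b) = 0 := by
  set I := ∫ z : ℂ, (radialWeight f z : ℂ) * (z ^ a * conj z ^ b) with hI
  have hd : ((a : ℂ) - b) ≠ 0 := sub_ne_zero.2 (by exact_mod_cast hab)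
  -- Rotation by this angle multiplies z^a conj(z)^b by exp(iπ) = -1 and preserves the weight, so
  -- the integral equals its own negative.
  let t : ℝ := Real.pi / ((a : ℝ) - b)
  let w : Circle := Circle.exp t
  have hw : (w : ℂ) ^ a * conj (w : ℂ) ^ b = -1 := by
    have h1 : conj (w : ℂ) = Complex.exp (-(t * Complex.I)) := by
      simp only [w, Circle.coe_exp, ← Complex.exp_conj, map_mul, Complex.conj_ofReal, Complex.conj_I]
      congr 1; ring
    rw [h1, Circle.coe_exp, ← Complex.exp_nat_mul, ← Complex.exp_nat_mul, ← Complex.exp_add,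
      ← Complex.exp_pi_mul_I]
    congr 1
    simp only [t]
    push_cast
    field_simp
    ring
  have h := (rotation w).measurePreserving.integral_comp
    (rotation w).toHomeomorph.measurableEmbedding
    (fun z : ℂ => (radialWeight f z : ℂ) * (z ^ a * conj z ^ b))
  have h2 : ∀ z : ℂ, (radialWeight f (rotation w z) : ℂ) *
      ((rotation w z) ^ a * conj (rotation w z) ^ b) =
        (-1) * ((radialWeight f z : ℂ) * (z ^ a * conj z ^ b)) := by
    intro z
    have : radialWeight f (rotation w z) = radialWeight f z := by
      simp only [radialWeight, LinearIsometryEquiv.norm_map]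
    rw [this, rotation_apply, map_mul, mul_pow, mul_pow, ← hw]
    ring
  simp_rw [h2] at h
  rw [integral_const_mul, ← hI] at h
  have : (2 : ℂ) * I = 0 := by linear_combination -h
  simpa using this

theorem integral_radialWeight_mul_self {f : ℝ → ℝ} (hf : Measurable f) (h0 : ∀ x, 0 ≤ f x) (a : ℕ) :
    ∫ z : ℂ, (radialWeight f z : ℂ) * (z ^ a * conj z ^ a) = ((radialMoment f a).toReal : ℂ) := by
  have h : ∀ z : ℂ, (radialWeight f z : ℂ) * (z ^ a * conj z ^ a) =
      ((radialWeight f z * ‖z‖ ^ (2 * a) : ℝ) : ℂ) := by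
    intro z
    rw [← mul_pow, Complex.mul_conj, Complex.normSq_eq_norm_sq]
    push_cast
    ring
  simp_rw [h]
  rw [integral_complex_ofReal, integral_eq_lintegral_of_nonneg_ae]
  · rfl
  · exact Filter.Eventually.of_forall fun z =>
      mul_nonneg (radialWeight_nonneg h0 z) (by positivity)
  · have := measurable_radialWeight hf
    exact Measurable.aestronglyMeasurable (by fun_prop)

theorem radialMoment_ne_top {f : ℝ → ℝ} (h1 : ∀ x, f x ≤ 1) (k : ℕ) :
    radialMoment f k ≠ ⊤ := by
  have h := (integrable_pow_mul_exp (2 * k)).lintegral_lt_top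
  refine ((lintegral_mono fun z => ENNReal.ofReal_le_ofReal ?_).trans_lt h).ne
  rw [radialWeight, mul_comm]
  have : f ‖z‖ * Real.exp (-‖z‖ ^ 2 / 2) ≤ 1 * Real.exp (-‖z‖ ^ 2 / 2) := by
    gcongr; exact h1 _
  rw [one_mul] at this
  gcongr

theorem radialMoment_one_ne_zero (k : ℕ) : radialMoment (fun _ => 1) k ≠ 0 := by
  have hm : Measurable fun z : ℂ => ENNReal.ofReal (radialWeight (fun _ => 1) z * ‖z‖ ^ (2 * k)) := by
    have := measurable_radialWeight (f := fun _ => 1) measurable_const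
    fun_prop
  rw [radialMoment, Ne, lintegral_eq_zero_iff hm]
  intro h
  have h2 : ∀ᵐ z : ℂ, z ≠ 0 := Measure.ae_ne volume 0
  obtain ⟨z, hz, hz0⟩ := (h.and h2).exists
  have : 0 < radialWeight (fun _ => 1) z * ‖z‖ ^ (2 * k) := by
    have := norm_pos_iff.2 hz0
    rw [radialWeight]
    positivity
  simp only [Pi.zero_apply, ENNReal.ofReal_eq_zero] at hz
  linarith

theorem sqVandermonde_eq {n : ℕ} (z : Fin n → ℂ) :
    sqVandermonde z = ENNReal.ofReal (‖(vandermonde z).det‖ ^ 2) := by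
  rw [det_vandermonde, norm_prod, ← Finset.prod_pow,
    ENNReal.ofReal_prod_of_nonneg fun _ _ => by positivity]
  refine Finset.prod_congr rfl fun i _ => ?_
  rw [norm_prod, ← Finset.prod_pow, ENNReal.ofReal_prod_of_nonneg fun _ _ => by positivity]

theorem sq_norm_det_vandermonde {n : ℕ} (z : Fin n → ℂ) :
    ((‖(vandermonde z).det‖ ^ 2 : ℝ) : ℂ) = ∑ σ : Equiv.Perm (Fin n), ∑ τ : Equiv.Perm (Fin n),
      ((σ.sign : ℤ) * (τ.sign : ℤ) : ℂ) * ∏ i, (z i ^ (σ i : ℕ) * conj (z i) ^ (τ i : ℕ)) := by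
  have h : (vandermonde z).det =
      ∑ σ : Equiv.Perm (Fin n), ((σ.sign : ℤ) : ℂ) * ∏ i, z i ^ (σ i : ℕ) := by
    rw [← det_transpose, det_apply']
    rfl
  rw [← Complex.normSq_eq_norm_sq, ← Complex.mul_conj, h, map_sum, Finset.sum_mul_sum]
  refine Finset.sum_congr rfl fun σ _ => Finset.sum_congr rfl fun τ _ => ?_
  rw [map_mul, map_prod, Finset.prod_mul_distrib]
  simp only [map_pow, map_intCast]
  ring

/-- Expand the squared Vandermonde determinant over pairs of permutations. If σ ≠ τ, some coordinate
integral vanishes by orthogonality; if σ = τ, the signs cancel and the same product of moments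
appears n! times. The bound on `f` gives the integrability needed to integrate termwise. -/
theorem jointIntegral_radial (n : ℕ) {f : ℝ → ℝ} (hf : Measurable f) (h0 : ∀ x, 0 ≤ f x)
    (h1 : ∀ x, f x ≤ 1) :
    jointIntegral n (fun z => ENNReal.ofReal (f ‖z‖)) =
      (n.factorial : ℝ≥0∞) * ∏ k : Fin n, radialMoment f k := by
  let F (a b : ℕ) (z : ℂ) : ℂ := (radialWeight f z : ℂ) * (z ^ a * conj z ^ b)
  let r (z : Fin n → ℂ) : ℝ := (∏ i, radialWeight f (z i)) * ‖(vandermonde z).det‖ ^ 2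
  have hr0 : ∀ z, 0 ≤ r z := fun z =>
    mul_nonneg (Finset.prod_nonneg fun i _ => radialWeight_nonneg h0 _) (by positivity)
  have hint : ∀ z : Fin n → ℂ, (∏ i, (ENNReal.ofReal (f ‖z i‖) * gaussDensity (z i))) *
      sqVandermonde z = ENNReal.ofReal (r z) := by
    intro z
    rw [sqVandermonde_eq, ENNReal.ofReal_mul (Finset.prod_nonneg fun i _ => radialWeight_nonneg h0 _),
      ENNReal.ofReal_prod_of_nonneg fun _ _ => radialWeight_nonneg h0 _]
    congr 1
    refine Finset.prod_congr rfl fun i _ => ?_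
    rw [radialWeight, ENNReal.ofReal_mul (h0 _), gaussDensity]
  have hrc : ∀ z, (r z : ℂ) = ∑ σ : Equiv.Perm (Fin n), ∑ τ : Equiv.Perm (Fin n),
      ((σ.sign : ℤ) * (τ.sign : ℤ) : ℂ) * ∏ i, F (σ i) (τ i) (z i) := by
    intro z
    simp only [r]
    rw [Complex.ofReal_mul, sq_norm_det_vandermonde, Finset.mul_sum]
    refine Finset.sum_congr rfl fun σ _ => ?_
    rw [Finset.mul_sum]
    refine Finset.sum_congr rfl fun τ _ => ?_
    simp only [F, Finset.prod_mul_distrib, Complex.ofReal_prod]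
    ring
  have hFi : ∀ σ τ : Equiv.Perm (Fin n), Integrable (fun z : Fin n → ℂ =>
      ((σ.sign : ℤ) * (τ.sign : ℤ) : ℂ) * ∏ i, F (σ i) (τ i) (z i)) (lebVec (Fin n)) := by
    intro σ τ
    exact (Integrable.fintype_prod (μ := fun _ => volume) fun i =>
      integrable_radialWeight_mul hf h0 h1 (σ i) (τ i)).const_mul _
  have hri : Integrable (fun z => (r z : ℂ)) (lebVec (Fin n)) := by
    simp_rw [hrc]
    exact integrable_finsetSum _ fun σ _ => integrable_finsetSum _ fun τ _ => hFi σ τ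
  have hI : ∫ z, (r z : ℂ) ∂lebVec (Fin n) =
      ((n.factorial * ∏ k : Fin n, (radialMoment f k).toReal : ℝ) : ℂ) := by
    simp_rw [hrc]
    rw [integral_finsetSum _ fun σ _ => integrable_finsetSum _ fun τ _ => hFi σ τ]
    have hσ : ∀ σ : Equiv.Perm (Fin n), ∫ z, ∑ τ : Equiv.Perm (Fin n),
        ((σ.sign : ℤ) * (τ.sign : ℤ) : ℂ) * ∏ i, F (σ i) (τ i) (z i) ∂lebVec (Fin n) =
          ∏ k : Fin n, ((radialMoment f k).toReal : ℂ) := by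
      intro σ
      rw [integral_finsetSum _ fun τ _ => hFi σ τ, Finset.sum_eq_single σ]
      · rw [integral_const_mul, lebVec, integral_fintype_prod_eq_prod]
        simp only [F]
        rw [Finset.prod_congr rfl fun i _ => integral_radialWeight_mul_self hf h0 (σ i),
          Equiv.prod_comp σ fun k => ((radialMoment f (k : ℕ)).toReal : ℂ)]
        rcases Int.units_eq_one_or σ.sign with h | h <;> simp [h]
      · intro τ _ hτ
        obtain ⟨i, hi⟩ : ∃ i, σ i ≠ τ i := by
          by_contra! h
          exact hτ (Equiv.ext fun i => (h i).symm)
        rw [integral_const_mul, lebVec, integral_fintype_prod_eq_prod,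
          Finset.prod_eq_zero (Finset.mem_univ i), mul_zero]
        exact integral_radialWeight_mul_of_ne fun h => hi (Fin.ext h)
      · simp
    rw [Finset.sum_congr rfl fun σ _ => hσ σ, Finset.sum_const, Finset.card_univ, Fintype.card_perm,
      Fintype.card_fin, nsmul_eq_mul]
    push_cast
    rfl
  have hI' : ∫ z, r z ∂lebVec (Fin n) = n.factorial * ∏ k : Fin n, (radialMoment f k).toReal := by
    rw [integral_complex_ofReal] at hI
    exact_mod_cast hI
  have hri' : Integrable r (lebVec (Fin n)) := by simpa using hri.re
  rw [jointIntegral]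
  simp_rw [hint]
  rw [← ofReal_integral_eq_lintegral_ofReal hri' (Filter.Eventually.of_forall hr0), hI',
    ENNReal.ofReal_mul (by positivity), ENNReal.ofReal_natCast,
    ENNReal.ofReal_prod_of_nonneg fun _ _ => ENNReal.toReal_nonneg]
  congr 1
  exact Finset.prod_congr rfl fun k _ => ENNReal.ofReal_toReal (radialMoment_ne_top h1 k)

end Ginibre

/-! ### Radial moments and the χ distribution -/

namespace Ginibre

open scoped ENNReal

theorem radialMoment_eq_lintegral_Ioi {f : ℝ → ℝ} (hf : Measurable f) (k : ℕ) :
    radialMoment f k = ENNReal.ofReal (2 * Real.pi) * ∫⁻ r in Set.Ioi (0 : ℝ),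
      ENNReal.ofReal (f r) * ENNReal.ofReal (r ^ (2 * k + 1) * Real.exp (-r ^ 2 / 2)) := by
  rw [radialMoment, ← Complex.lintegral_comp_polarCoord_symm, polarCoord_target,
    Measure.volume_eq_prod, ← Measure.prod_restrict, lintegral_prod]
  · rw [← lintegral_const_mul]
    · refine setLIntegral_congr_fun measurableSet_Ioi fun r hr => ?_
      have hr0 : (0 : ℝ) < r := hr
      simp only [Complex.norm_polarCoord_symm, radialWeight, smul_eq_mul, abs_of_pos hr0]
      have he : 0 ≤ r ^ (2 * k + 1) * Real.exp (-r ^ 2 / 2) := by positivity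
      rw [lintegral_const, Measure.restrict_apply_univ, Real.volume_Ioo,
        ← ENNReal.ofReal_mul hr0.le, mul_comm, ← ENNReal.ofReal_mul' he]
      congr 2
      · ring
      · ring
    · fun_prop
  · simp only [Complex.norm_polarCoord_symm, radialWeight, smul_eq_mul]
    exact Measurable.aemeasurable (by fun_prop)

/-- The polar Jacobian raises r^(2k) to r^(2k+1), the power in the χ density with 2(k+1) degrees of
freedom. -/
theorem exists_lintegral_chiMeasure_eq (k : ℕ) : ∃ c : ℝ≥0∞, ∀ f : ℝ → ℝ, Measurable f →
    ∫⁻ x, ENNReal.ofReal (f x) ∂chiMeasure (2 * (k + 1)) = c * radialMoment f k := by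
  let d : ℝ := 2 ^ (((2 * (k + 1) : ℕ) : ℝ) / 2 - 1) * Real.Gamma (((2 * (k + 1) : ℕ) : ℝ) / 2)
  have hd : 0 < d := by
    have : 0 < Real.Gamma (((2 * (k + 1) : ℕ) : ℝ) / 2) := Real.Gamma_pos_of_pos (by positivity)
    positivity
  have hpi : ENNReal.ofReal (2 * Real.pi) ≠ 0 := by
    have := Real.pi_pos
    simpa using by positivity
  refine ⟨ENNReal.ofReal d⁻¹ * (ENNReal.ofReal (2 * Real.pi))⁻¹, fun f hf => ?_⟩
  rw [radialMoment_eq_lintegral_Ioi hf, mul_assoc, ← mul_assoc _ _ (lintegral _ _),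
    ENNReal.inv_mul_cancel hpi ENNReal.ofReal_ne_top, one_mul, chiMeasure,
    lintegral_withDensity_eq_lintegral_mul _ (by fun_prop) (by fun_prop), ← lintegral_const_mul _ (by fun_prop)]
  refine setLIntegral_congr_fun measurableSet_Ioi fun r hr => ?_
  have hr0 : (0 : ℝ) < r := hr
  have h : r ^ (((2 * (k + 1) : ℕ) : ℝ) - 1) = r ^ (2 * k + 1) := by
    rw [← Real.rpow_natCast]
    congr 1
    push_cast
    ring
  simp only [Pi.mul_apply]
  rw [h, mul_comm (ENNReal.ofReal (f r)), ← mul_assoc, ← ENNReal.ofReal_mul (inv_nonneg.2 hd.le),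
    div_eq_inv_mul]

end Ginibre

/-! ### Equality of the product expectations -/

namespace Ginibre

open Matrix Polynomial
open scoped ENNReal

variable {Ω Ω' : Type*} [MeasurableSpace Ω] [MeasurableSpace Ω'] {P : Measure Ω} {P' : Measure Ω'}
  {n : ℕ} {M : Ω → Matrix (Fin n) (Fin n) ℂ} {X : Fin n → Ω' → ℝ}

theorem IsGinibre.aemeasurable (hM : IsGinibre M P) : AEMeasurable (fun ω i j => M ω i j) P :=
  aemeasurable_pi_lambda _ fun i => aemeasurable_pi_lambda _ fun j => (hM.entry_law i j).aemeasurable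

theorem IsGinibre.aemeasurable_eigenvalueModuli (hM : IsGinibre M P) :
    AEMeasurable (fun ω => eigenvalueModuli (M ω)) P := by
  have h : Measurable fun A : Fin n → Fin n → ℂ => eigenvalueModuli (of A) := by
    refine measurable_comp_roots_charpoly (F := fun s => s.map fun z => ‖z‖) ?_
    simp only [Multiset.map_map]
    exact measurable_univ_map.comp
      (measurable_pi_lambda _ fun i => (measurable_pi_apply i).norm)
  exact h.comp_aemeasurable hM.aemeasurable

theorem IsGinibre.exists_lintegral_prod_eq [IsProbabilityMeasure P] (hM : IsGinibre M P) :
    ∃ C : ℝ≥0∞, ∀ f : ℝ → ℝ, Measurable f → (∀ x, 0 ≤ f x) → (∀ x, f x ≤ 1) →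
      ∫⁻ ω, ((eigenvalueModuli (M ω)).map fun x => ENNReal.ofReal (f x)).prod ∂P =
        C * ∏ k : Fin n, radialMoment f k := by
  obtain ⟨c, hc⟩ := hM.exists_map_eq
  obtain ⟨C, hC⟩ := exists_eigenIntegral_eq n
  refine ⟨c * C * n.factorial, fun f hf h0 h1 => ?_⟩
  have hg : Measurable fun z : ℂ => ENNReal.ofReal (f ‖z‖) := by fun_prop
  have h := hC _ hg
  rw [jointIntegral_radial n hf h0 h1, eigenIntegral] at h
  have hr := measurable_rootProd (n := n) hg
  have hd : Measurable fun A : Fin n → Fin n → ℂ => matDensity (of A) := measurable_matDensity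
  calc ∫⁻ ω, ((eigenvalueModuli (M ω)).map fun x => ENNReal.ofReal (f x)).prod ∂P
      = ∫⁻ ω, rootProd (fun z => ENNReal.ofReal (f ‖z‖)) (of fun i j => M ω i j) ∂P := by
        refine lintegral_congr fun ω => ?_
        rw [eigenvalueModuli, Multiset.map_map]
        rfl
    _ = ∫⁻ A, rootProd (fun z => ENNReal.ofReal (f ‖z‖)) (of A) ∂P.map (fun ω i j => M ω i j) :=
        (lintegral_map' hr.aemeasurable hM.aemeasurable).symm
    _ = c * ∫⁻ A, rootProd (fun z => ENNReal.ofReal (f ‖z‖)) (of A) * matDensity (of A)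
          ∂lebMat (Fin n) := by
        have hp : Measurable fun A : Fin n → Fin n → ℂ =>
            rootProd (fun z => ENNReal.ofReal (f ‖z‖)) (of A) * matDensity (of A) := hr.mul hd
        rw [hc, lintegral_withDensity_eq_lintegral_mul _ (hd.const_mul c) hr,
          ← lintegral_const_mul _ hp]
        refine lintegral_congr fun A => ?_
        simp only [Pi.mul_apply]
        ring
    _ = _ := by rw [h]; ring

theorem lintegral_prod_eq_of_iIndepFun (hX : ∀ i, AEMeasurable (X i) P') (hindep : iIndepFun X P')
    {f : ℝ → ℝ≥0∞} (hf : Measurable f) :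
    ∫⁻ ω, ∏ k, f (X k ω) ∂P' = ∏ k, ∫⁻ x, f x ∂P'.map (X k) := by
  have hX' : ∀ i, X i =ᵐ[P'] (hX i).mk (X i) := fun i => (hX i).ae_eq_mk
  have hi := (hindep.congr hX').comp (fun _ => f) fun _ => hf
  have h := lintegral_prod_eq_prod_lintegral_of_indepFun Finset.univ _ hi
    fun i => hf.comp (hX i).measurable_mk
  calc ∫⁻ ω, ∏ k, f (X k ω) ∂P' = ∫⁻ ω, ∏ k, f ((hX k).mk (X k) ω) ∂P' := by
        refine lintegral_congr_ae ?_
        filter_upwards [ae_all_iff.2 hX'] with ω h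
        exact Finset.prod_congr rfl fun k _ => by rw [h k]
    _ = ∏ k, ∫⁻ ω, f ((hX k).mk (X k) ω) ∂P' := h
    _ = _ := by
        refine Finset.prod_congr rfl fun k _ => ?_
        rw [lintegral_map' hf.aemeasurable (hX k)]
        refine lintegral_congr_ae ?_
        filter_upwards [hX' k] with ω h
        rw [h]

theorem IsGinibre.lintegral_prod_eq [IsProbabilityMeasure P] [IsProbabilityMeasure P']
    (hM : IsGinibre M P) (hX : ∀ k : Fin n, HasLaw (X k) (chiMeasure (2 * ((k : ℕ) + 1))) P')
    (hindep : iIndepFun X P') {f : ℝ → ℝ} (hf : Measurable f) (h0 : ∀ x, 0 ≤ f x)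
    (h1 : ∀ x, f x ≤ 1) :
    ∫⁻ ω, ((eigenvalueModuli (M ω)).map fun x => ENNReal.ofReal (f x)).prod ∂P =
      ∫⁻ ω, (((Finset.univ : Finset (Fin n)).val.map fun k => X k ω).map
        fun x => ENNReal.ofReal (f x)).prod ∂P' := by
  obtain ⟨C, hC⟩ := hM.exists_lintegral_prod_eq
  choose c hc using exists_lintegral_chiMeasure_eq
  have key : ∀ f : ℝ → ℝ, Measurable f →
      ∫⁻ ω, (((Finset.univ : Finset (Fin n)).val.map fun k => X k ω).map
        fun x => ENNReal.ofReal (f x)).prod ∂P' =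
        (∏ k : Fin n, c k) * ∏ k : Fin n, radialMoment f k := by
    intro f hf
    simp only [Multiset.map_map]
    rw [← Finset.prod_mul_distrib]
    refine (lintegral_prod_eq_of_iIndepFun (fun i => (hX i).aemeasurable) hindep
      (f := fun x => ENNReal.ofReal (f x)) (by fun_prop)).trans ?_
    exact Finset.prod_congr rfl fun k _ => by rw [(hX k).map_eq, hc k f hf]
  -- Both expectations equal 1 for f = 1, and the product of moments is then nonzero and finite, so
  -- the two unknown constants agree.
  have e1 := hC (fun _ => 1) measurable_const (by simp) (by simp)
  have e2 := key (fun _ => 1) measurable_const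
  simp only [ENNReal.ofReal_one, Multiset.map_const', Multiset.prod_replicate, one_pow,
    lintegral_one, measure_univ] at e1 e2
  have hne : ∏ k : Fin n, radialMoment (fun _ => 1) k ≠ 0 :=
    Finset.prod_ne_zero_iff.2 fun k _ => radialMoment_one_ne_zero k
  have htop : ∏ k : Fin n, radialMoment (fun _ => 1) k ≠ ⊤ :=
    ENNReal.prod_ne_top fun k _ => radialMoment_ne_top (by simp) k
  rw [hC f hf h0 h1, key f hf, (ENNReal.mul_left_inj hne htop).1 (e1.symm.trans e2)]

end Ginibre

/-! ### Product expectations determine the law of a configuration -/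

namespace Ginibre

open Polynomial
open scoped ENNReal

/-- A finite measure on `ℕ` with bounded support is determined by its generating function. -/
theorem measure_nat_ext_of_lintegral_pow {μ ν : Measure ℕ} [IsFiniteMeasure μ] [IsFiniteMeasure ν]
    {K : ℕ} (hμ : ∀ᵐ k ∂μ, k < K) (hν : ∀ᵐ k ∂ν, k < K)
    (h : ∀ t : ℝ, 0 ≤ t → t ≤ 1 →
      ∫⁻ k, ENNReal.ofReal t ^ k ∂μ = ∫⁻ k, ENNReal.ofReal t ^ k ∂ν) : μ = ν := by
  let p (ρ : Measure ℕ) : ℝ[X] := ∑ k ∈ Finset.range K, C (ρ.real {k}) * X ^ k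
  have hz : ∀ ρ : Measure ℕ, (∀ᵐ k ∂ρ, k < K) → ∀ k, K ≤ k → ρ {k} = 0 := fun ρ hρ k hk =>
    measure_mono_null (fun x hx => by
      rw [Set.mem_singleton_iff.1 hx]; exact not_lt.2 hk) (ae_iff.1 hρ)
  have hp : ∀ ρ : Measure ℕ, IsFiniteMeasure ρ → (∀ᵐ k ∂ρ, k < K) → ∀ t : ℝ, 0 ≤ t →
      ∫⁻ k, ENNReal.ofReal t ^ k ∂ρ = ENNReal.ofReal ((p ρ).eval t) := by
    intro ρ _ hρ t ht
    rw [lintegral_countable', tsum_eq_sum (s := Finset.range K) fun k hk => by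
      rw [hz ρ hρ k (by simpa using hk), mul_zero], eval_finsetSum,
      ENNReal.ofReal_sum_of_nonneg fun k _ => by
        simpa using mul_nonneg measureReal_nonneg (pow_nonneg ht k)]
    refine Finset.sum_congr rfl fun k _ => ?_
    rw [eval_mul, eval_C, eval_pow, eval_X, ENNReal.ofReal_mul measureReal_nonneg,
      ENNReal.ofReal_pow ht, ofReal_measureReal, mul_comm]
  have hpos : ∀ (ρ : Measure ℕ) (t : ℝ), 0 ≤ t → 0 ≤ (p ρ).eval t := by
    intro ρ t ht
    rw [eval_finsetSum]
    exact Finset.sum_nonneg fun k _ => by simpa using mul_nonneg measureReal_nonneg (pow_nonneg ht k)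
  -- Bounded support makes the generating functions polynomials, and polynomials that agree on [0,
  -- 1] coincide.
  have heq : p μ = p ν := by
    refine eq_of_infinite_eval_eq _ _ ((Set.Icc_infinite zero_lt_one).mono fun t ht => ?_)
    have := h t ht.1 ht.2
    rw [hp μ inferInstance hμ t ht.1, hp ν inferInstance hν t ht.1] at this
    exact (ENNReal.ofReal_eq_ofReal_iff (hpos μ t ht.1) (hpos ν t ht.1)).1 this
  refine Measure.ext_of_singleton fun k => ?_
  by_cases hk : k < K
  · have hc : ∀ ρ : Measure ℕ, (p ρ).coeff k = ρ.real {k} := by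
      intro ρ
      simp [p, coeff_C_mul, coeff_X_pow, hk]
    have := congrArg (fun q => q.coeff k) heq
    simp only [hc] at this
    exact (ENNReal.toReal_eq_toReal_iff' (measure_ne_top _ _) (measure_ne_top _ _)).1 this
  · rw [hz μ hμ k (not_lt.1 hk), hz ν hν k (not_lt.1 hk)]

open Classical in
/-- The numbers of points in finitely many sets, encoded as the digits of a natural number in base
`n + 1`. -/
noncomputable def encodeCounts {α : Type*} (n : ℕ) {m : ℕ} (B : Fin m → Set α) (s : Multiset α) : ℕ :=
  ∑ i, s.countP (· ∈ B i) * (n + 1) ^ (i : ℕ)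

section

variable {α : Type*} {n m : ℕ} {B : Fin m → Set α}

open Classical in
theorem encodeCounts_eq_val {s : Multiset α} (hs : s.card = n) :
    encodeCounts n B s = (finFunctionFinEquiv fun i =>
      (⟨s.countP (· ∈ B i), Nat.lt_succ_of_le (hs ▸ Multiset.countP_le_card _ _)⟩ : Fin (n + 1))).val :=
  rfl

theorem encodeCounts_lt {s : Multiset α} (hs : s.card = n) :
    encodeCounts n B s < (n + 1) ^ m := by
  rw [encodeCounts_eq_val hs]
  exact Fin.is_lt _

open Classical in
theorem countP_eq_of_encodeCounts_eq {s t : Multiset α} (hs : s.card = n) (ht : t.card = n)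
    (h : encodeCounts n B s = encodeCounts n B t) (i : Fin m) :
    s.countP (· ∈ B i) = t.countP (· ∈ B i) := by
  rw [encodeCounts_eq_val hs, encodeCounts_eq_val ht] at h
  have := congrFun (finFunctionFinEquiv.injective (Fin.ext h)) i
  exact congrArg Fin.val this

-- The generating function of the encoded counts is the expectation of a product over the points, so
-- a single parameter t captures the joint law of several counts.
open Classical in
theorem prod_map_pow_eq_pow_encodeCounts (a : ℝ≥0∞) (s : Multiset α) :
    (s.map fun x => a ^ ∑ i, (if x ∈ B i then 1 else 0) * (n + 1) ^ (i : ℕ)).prod =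
      a ^ encodeCounts n B s := by
  induction s using Multiset.induction_on with
  | empty => simp [encodeCounts]
  | cons x s ih =>
    rw [Multiset.map_cons, Multiset.prod_cons, ih, ← pow_add, encodeCounts, encodeCounts,
      ← Finset.sum_add_distrib]
    congr 1
    refine Finset.sum_congr rfl fun i _ => ?_
    rw [← add_mul, Multiset.countP_cons, add_comm]

theorem measurable_encodeCounts [MeasurableSpace α] (hB : ∀ i, MeasurableSet (B i)) :
    Measurable (encodeCounts n B) :=
  Finset.measurable_sum _ fun i _ => (measurable_countP (hB i)).mul_const _

theorem ae_card_map {Ω : Type*} [MeasurableSpace Ω] [MeasurableSpace α] {P : Measure Ω}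
    {f : Ω → Multiset α} (hf : AEMeasurable f P) (h : ∀ ω, (f ω).card = n) :
    ∀ᵐ s ∂P.map f, s.card = n := by
  classical
  have hc : Measurable fun s : Multiset α => s.card := by
    convert measurable_countP (α := α) MeasurableSet.univ using 2 with s
    simp
  exact (ae_map_iff hf (p := fun s => s.card = n) (hc (measurableSet_singleton n))).2
    (Filter.Eventually.of_forall h)

/-- The law of a point configuration with a fixed number of points is determined by the
expectations of the products of a function over the points. -/
theorem identDistrib_of_lintegral_prod_eq [MeasurableSpace α] {Ω Ω' : Type*} [MeasurableSpace Ω]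
    [MeasurableSpace Ω'] {P : Measure Ω} {P' : Measure Ω'} [IsProbabilityMeasure P]
    [IsProbabilityMeasure P'] {F : Ω → Multiset α} {G : Ω' → Multiset α} (hF : AEMeasurable F P)
    (hG : AEMeasurable G P') (hFn : ∀ ω, (F ω).card = n) (hGn : ∀ ω, (G ω).card = n)
    (h : ∀ f : α → ℝ, Measurable f → (∀ x, 0 ≤ f x) → (∀ x, f x ≤ 1) →
      ∫⁻ ω, ((F ω).map fun x => ENNReal.ofReal (f x)).prod ∂P =
        ∫⁻ ω, ((G ω).map fun x => ENNReal.ofReal (f x)).prod ∂P') : IdentDistrib F G P P' := by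
  refine ⟨hF, hG, ?_⟩
  set μ := P.map F with hμP
  set ν := P'.map G with hνP
  have : IsProbabilityMeasure μ := Measure.isProbabilityMeasure_map hF
  have : IsProbabilityMeasure ν := Measure.isProbabilityMeasure_map hG
  have hμ : ∀ᵐ s ∂μ, s.card = n := ae_card_map hF hFn
  have hν : ∀ᵐ s ∂ν, s.card = n := ae_card_map hG hGn
  classical
  have hcode : ∀ (m : ℕ) (B : Fin m → Set α), (∀ i, MeasurableSet (B i)) →
      μ.map (encodeCounts n B) = ν.map (encodeCounts n B) := by
    intro m B hB
    have hW := measurable_encodeCounts (n := n) hB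
    have := Measure.isProbabilityMeasure_map (μ := μ) hW.aemeasurable
    have := Measure.isProbabilityMeasure_map (μ := ν) hW.aemeasurable
    refine measure_nat_ext_of_lintegral_pow (K := (n + 1) ^ m) ?_ ?_ fun t ht0 ht1 => ?_
    · rw [ae_map_iff hW.aemeasurable (.of_discrete)]
      exact hμ.mono fun s hs => encodeCounts_lt hs
    · rw [ae_map_iff hW.aemeasurable (.of_discrete)]
      exact hν.mono fun s hs => encodeCounts_lt hs
    · have hp : Measurable fun s : Multiset α => ENNReal.ofReal t ^ encodeCounts n B s :=
        (Measurable.of_discrete (f := fun k : ℕ => ENNReal.ofReal t ^ k)).comp hW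
      rw [lintegral_map .of_discrete hW, lintegral_map .of_discrete hW, hμP, hνP,
        lintegral_map' hp.aemeasurable hF, lintegral_map' hp.aemeasurable hG]
      simp_rw [← prod_map_pow_eq_pow_encodeCounts, ← ENNReal.ofReal_pow ht0]
      refine h _ ?_ (fun x => by positivity) fun x => pow_le_one₀ ht0 ht1
      refine (Measurable.of_discrete (f := fun k : ℕ => t ^ k)).comp ?_
      exact Finset.measurable_sum _ fun i _ =>
        (Measurable.ite (hB i) measurable_const measurable_const).mul_const _
  let κ (B : {B : Set α // MeasurableSet B}) : MeasurableSpace (Multiset α) :=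
    MeasurableSpace.comap (fun s => s.countP (· ∈ B.1)) ⊤
  -- Finite intersections of events, each depending on one count, form a π-system generating the
  -- σ-algebra.
  refine ext_of_generate_finite
    (piiUnionInter (fun B => {s | MeasurableSet[κ B] s}) Set.univ) ?_
    (isPiSystem_piiUnionInter _ (fun B => (κ B).isPiSystem_measurableSet) _) ?_ (by simp)
  · refine Eq.trans ?_ (generateFrom_piiUnionInter_measurableSet κ Set.univ).symm
    rw [instMeasurableSpaceMultiset, iSup_subtype']
    simp [κ]
  · rintro A ⟨t, -, D, hD, rfl⟩
    let e := t.equivFin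
    let B (i : Fin t.card) : Set α := (e.symm i).1.1
    have hB : ∀ i, MeasurableSet (B i) := fun i => (e.symm i).1.2
    have hW := measurable_encodeCounts (n := n) hB
    have hmem : ∀ s s' : Multiset α, s.card = n → s'.card = n →
        encodeCounts n B s = encodeCounts n B s' →
        s ∈ ⋂ x ∈ t, D x → s' ∈ ⋂ x ∈ t, D x := by
      intro s s' hs hs' hW hsD
      simp only [Set.mem_iInter] at hsD ⊢
      intro x hx
      obtain ⟨E, -, hE⟩ := hD x hx
      have hc := countP_eq_of_encodeCounts_eq hs hs' hW (e ⟨x, hx⟩)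
      simp only [B, Equiv.symm_apply_apply] at hc
      have := hsD x hx
      rw [← hE] at this ⊢
      simpa only [Set.mem_preimage, hc] using this
    -- On configurations of n points the digits recover the counts, so up to a null set the event is
    -- the preimage of its image under the encoding, and `hcode` applies.
    have hA : ∀ ρ : Measure (Multiset α), (∀ᵐ s ∂ρ, s.card = n) →
        ρ (⋂ x ∈ t, D x) = ρ.map (encodeCounts n B)
          (encodeCounts n B '' {s | s.card = n ∧ s ∈ ⋂ x ∈ t, D x}) := by
      intro ρ hρ
      rw [Measure.map_apply hW .of_discrete]
      refine measure_congr ?_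
      filter_upwards [hρ] with s hs
      refine propext ⟨fun hsD => ⟨s, ⟨hs, hsD⟩, rfl⟩, ?_⟩
      rintro ⟨s', ⟨hs', hsD⟩, hW⟩
      exact hmem s' s hs' hs hW hsD
    rw [hA μ hμ, hA ν hν, hcode _ _ hB]

end

end Ginibre

theorem theorem7 {Ω Ω' : Type*} [MeasurableSpace Ω] [MeasurableSpace Ω']
    (P : Measure Ω) [IsProbabilityMeasure P] (P' : Measure Ω') [IsProbabilityMeasure P']
    (n : ℕ) (M : Ω → Matrix (Fin n) (Fin n) ℂ) (hM : Ginibre.IsGinibre M P)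
    (X : Fin n → Ω' → ℝ)
    (hX : ∀ k : Fin n, HasLaw (X k) (Ginibre.chiMeasure (2 * ((k : ℕ) + 1))) P')
    (hindep : iIndepFun X P') :
    IdentDistrib (fun ω => Ginibre.eigenvalueModuli (M ω))
      (fun ω' => (Finset.univ : Finset (Fin n)).val.map fun k => X k ω') P P' := by
  have hm := hM.aemeasurable_eigenvalueModuli
  have hm' : AEMeasurable
      (fun ω' => (Finset.univ : Finset (Fin n)).val.map fun k => X k ω') P' :=
    Ginibre.measurable_univ_map.comp_aemeasurable
      (aemeasurable_pi_lambda (fun ω' k => X k ω') fun k => (hX k).aemeasurable)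
  refine Ginibre.identDistrib_of_lintegral_prod_eq (n := n) hm hm' (fun ω => ?_) (fun ω => by simp)
    fun f hf h0 h1 => hM.lintegral_prod_eq hX hindep hf h0 h1
  rw [Ginibre.eigenvalueModuli, Multiset.card_map, IsAlgClosed.card_roots_eq_natDegree,
    Matrix.charpoly_natDegree_eq_dim, Fintype.card_fin]
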